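/- Let $h\in\mathbb{C}$ and let $I$ be a linearly ordered index set containing six distinct elements denoted $0,1,\dots,5$. Let $H_I$ be the complex unital algebra with generators $x_i,y_i$ ($i\in I$) and relations $$x_iy_i=y_ix_i+hy_i^2,\quad x_jy_i=y_ix_j+hy_iy_j,\quad y_jx_i=x_iy_j-hy_iy_j,\quad y_jy_i=y_iy_j,\quad x_jx_i=x_ix_j-hx_iy_j+hy_ix_j+h^2y_iy_j\qquad(i<j),$$ and let $Q_I$ be its skew field of quotients. For pairs $(X,Y),(X',Y')$ of elements of a skew field extension of $Q_I$ put $\big((X,Y)(X',Y')\big)=XY'-YX'-hYY'$; write $(ij)$ for the bracket of $(x_i,y_i)$ and $(x_j,y_j)$, and $(X\,j)$ for the bracket of $(X,Y)$ and $(x_j,y_j)$. Write $x=x_0$, $y=y_0$. Let $L\supseteq Q_I$ be a skew field and let $T\subseteq L$ be a set of elements that are central in $L$ and algebraic over the field of those elements of $Q_{I\setminus\{0\}}$ that are central in $L$ (for instance the elements of a splitting field over the invariants). Here $Q_{I\setminus\{0\}}\subseteq L$ is the skew subfield generated over $\mathbb{C}$ by the $x_i,y_i$ with $i\ne 0$,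 and $Q_{I\setminus\{0\}}^{T}$ denotes the skew subfield generated by $Q_{I\setminus\{0\}}$ and $T$. Let $C,X_1,Y_1,X_2,Y_2,X_3,Y_3\in Q_{I\setminus\{0\}}^{T}$ be such that the three linear forms $xY_i-yX_i-hyY_i$ are central in $L$ and the cubic form $r=(01)(02)(03)-(04)(05)^2$ decomposes as $$r=C\prod_{i=1}^{3}(xY_i-yX_i-hyY_i).$$ Let $w^{(1)},w^{(2)},w^{(3)}$ be central elements of $L$ with $(w^{(i)})^2=(X_i1)(X_i2)(X_i3)(X_i4)$, and suppose that $L$ is generated as a skew field by $Q_I$, $T$ and the $w^{(i)}$. Let $K\subseteq I$ with $0,5\in K$ and $1,2,3,4\notin K$, and let $\Gamma=L\,d_K L$ be the differential module: the $L$-bimodule generated by symbols $da$ ($a\in L$) with the defining relations $d(\alpha a+\beta b)=\alpha\,da+\beta\,db$, $d(ab)=da\cdot b+a\,db$, $d1=0$ ($a,b\in L$, $\alpha,\beta\in\mathbb{C}$); $dx_i=dy_i=0$ for $i\in I\setminus K$; $$dx_j\cdot x_i=x_idx_j-hx_idy_j+hy_idx_j+h^2y_idy_j,\quad dx_j\cdot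 y_i=y_idx_j+hy_idy_j,\quad dy_j\cdot y_i=y_idy_j,\quad dy_j\cdot x_i=x_idy_j-hy_idy_j$$ for $i\in I$, $j\in K$; and $s\,da=da\cdot s$, $a\,ds=ds\cdot a$ for $a\in L$ and $s\in T\cup\{w^{(1)},w^{(2)},w^{(3)}\}$. Define the elliptic differentials of the first kind $$de_{X_i,Y_i}=(w^{(i)})^{-1}\,(Y_i\,dX_i-X_i\,dY_i+hY_i\,dY_i)\in\Gamma .$$ Then there are signs $\epsilon_1,\epsilon_2,\epsilon_3\in\{1,-1\}$ with $$\epsilon_1\,de_{X_1,Y_1}+\epsilon_2\,de_{X_2,Y_2}+\epsilon_3\,de_{X_3,Y_3}=0\quad\text{in }\Gamma .$$ -/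

import Mathlib

open scoped TensorProduct

namespace HDeformed

universe u v

section CoordinateAlgebra

/-- The generator `x_i` of the free algebra on the symbols `x_i, y_i`, `i ∈ I`. -/
abbrev freeX {I : Type u} (i : I) : FreeAlgebra ℂ (I ⊕ I) := FreeAlgebra.ι ℂ (Sum.inl i)

/-- The generator `y_i` of the free algebra on the symbols `x_i, y_i`, `i ∈ I`. -/
abbrev freeY {I : Type u} (i : I) : FreeAlgebra ℂ (I ⊕ I) := FreeAlgebra.ι ℂ (Sum.inr i)

/-- The quadratic relations of the algebra of `h`-deformed homogeneous coordinates. -/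
inductive CoordRel (h : ℂ) (I : Type u) [LinearOrder I] :
    FreeAlgebra ℂ (I ⊕ I) → FreeAlgebra ℂ (I ⊕ I) → Prop
  | xy_same (i : I) :
      CoordRel h I (freeX i * freeY i) (freeY i * freeX i + h • (freeY i * freeY i))
  | xy (i j : I) (hij : i < j) :
      CoordRel h I (freeX j * freeY i) (freeY i * freeX j + h • (freeY i * freeY j))
  | yx (i j : I) (hij : i < j) :
      CoordRel h I (freeY j * freeX i) (freeX i * freeY j - h • (freeY i * freeY j))
  | yy (i j : I) (hij : i < j) :
      CoordRel h I (freeY j * freeY i) (freeY i * freeY j)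
  | xx (i j : I) (hij : i < j) :
      CoordRel h I (freeX j * freeX i)
        (freeX i * freeX j - h • (freeX i * freeY j) + h • (freeY i * freeX j)
          + h ^ 2 • (freeY i * freeY j))

/-- The algebra `H_I` of `h`-deformed homogeneous coordinates of points indexed by `I`. -/
abbrev CoordAlg (h : ℂ) (I : Type u) [LinearOrder I] : Type u := RingQuot (CoordRel h I)

/-- The generator `x_i` of `H_I`. -/
noncomputable def coordX (h : ℂ) {I : Type u} [LinearOrder I] (i : I) : CoordAlg h I :=
  RingQuot.mkAlgHom ℂ (CoordRel h I) (freeX i)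

/-- The generator `y_i` of `H_I`. -/
noncomputable def coordY (h : ℂ) {I : Type u} [LinearOrder I] (i : I) : CoordAlg h I :=
  RingQuot.mkAlgHom ℂ (CoordRel h I) (freeY i)

end CoordinateAlgebra

section QuotientSkewField

/-- Relations saying that the symbols `inl a` multiply and add like the elements `a` of the
`ℂ`-algebra `R`, and that `inr a` is a two-sided inverse of the nonzero element `a`. -/
inductive FracRel (R : Type u) [Ring R] [Algebra ℂ R] :
    FreeAlgebra ℂ (R ⊕ {a : R // a ≠ 0}) → FreeAlgebra ℂ (R ⊕ {a : R // a ≠ 0}) → Prop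
  | scalar (c : ℂ) :
      FracRel R (FreeAlgebra.ι ℂ (Sum.inl (algebraMap ℂ R c))) (algebraMap ℂ _ c)
  | add (a b : R) :
      FracRel R (FreeAlgebra.ι ℂ (Sum.inl (a + b)))
        (FreeAlgebra.ι ℂ (Sum.inl a) + FreeAlgebra.ι ℂ (Sum.inl b))
  | mul (a b : R) :
      FracRel R (FreeAlgebra.ι ℂ (Sum.inl (a * b)))
        (FreeAlgebra.ι ℂ (Sum.inl a) * FreeAlgebra.ι ℂ (Sum.inl b))
  | mul_inv (a : {a : R // a ≠ 0}) :
      FracRel R (FreeAlgebra.ι ℂ (Sum.inl a.1) * FreeAlgebra.ι ℂ (Sum.inr a)) 1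
  | inv_mul (a : {a : R // a ≠ 0}) :
      FracRel R (FreeAlgebra.ι ℂ (Sum.inr a) * FreeAlgebra.ι ℂ (Sum.inl a.1)) 1

/-- The localization of `R` at all its nonzero elements, i.e. the universal `ℂ`-algebra under `R`
in which every nonzero element of `R` becomes invertible. If `R` is an Ore domain, as is the case
for `H_I`, this is the skew field of quotients `a b⁻¹` of `R`. -/
abbrev QuotRing (R : Type u) [Ring R] [Algebra ℂ R] : Type u := RingQuot (FracRel R)

/-- The canonical map from `R` to its localization at all nonzero elements. -/
noncomputable def toQuotRing {R : Type u} [Ring R] [Algebra ℂ R] (a : R) : QuotRing R :=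
  RingQuot.mkAlgHom ℂ (FracRel R) (FreeAlgebra.ι ℂ (Sum.inl a))

/-- The quotient skew field `Q_I` of `H_I`. -/
abbrev CoordField (h : ℂ) (I : Type u) [LinearOrder I] : Type u := QuotRing (CoordAlg h I)

end QuotientSkewField

section Extensions

variable {h : ℂ} {I : Type u} [LinearOrder I] {L : Type v} [DivisionRing L] [Algebra ℂ L]

/-- The pair of homogeneous coordinates `(x_i, y_i)`, in a skew field extension `L` of `Q_I`. -/
noncomputable def pt (ψ : CoordField h I →ₐ[ℂ] L) (i : I) : L × L :=
  (ψ (toQuotRing (coordX h i)), ψ (toQuotRing (coordY h i)))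

/-- The skew subfield `Q_J` of `L` generated over `ℂ` by the `x_j, y_j` with `j ∈ J`. -/
noncomputable def subQ (ψ : CoordField h I →ₐ[ℂ] L) (J : Set I) : Subfield L :=
  Subfield.closure (Set.range (algebraMap ℂ L) ∪ (fun j => (pt ψ j).1) '' J ∪
    (fun j => (pt ψ j).2) '' J)

/-- The extension `Q_J^T` of `Q_J` inside `L`, generated by `Q_J` and a set `T` of elements. -/
noncomputable def subQAdjoin (ψ : CoordField h I →ₐ[ℂ] L) (J : Set I) (T : Set L) : Subfield L :=
  Subfield.closure (subQ ψ J ∪ T)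

/-- `T` consists of elements which are central in `L` and algebraic over the field of those
elements of `Q_J` which are central in `L` (in particular, elements which are algebraic over the
field of invariants of `Q_J` are of this kind). -/
def IsCentralAlgebraic (ψ : CoordField h I →ₐ[ℂ] L) (J : Set I) (T : Set L) : Prop :=
  ∀ σ ∈ T, σ ∈ Subring.center L ∧
    ∃ P : Polynomial L, P ≠ 0 ∧ (∀ n, P.coeff n ∈ subQ ψ J ∧ P.coeff n ∈ Subring.center L) ∧
      P.eval σ = 0

end Extensions

/-- The `h`-deformed bracket symbol of two points `p = (p₁, p₂)` and `q = (q₁, q₂)`. -/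
def bracket {L : Type v} [DivisionRing L] [Algebra ℂ L] (h : ℂ) (p q : L × L) : L :=
  p.1 * q.2 - p.2 * q.1 - h • (p.2 * q.2)

section Differentials

/-- The enveloping algebra of `L`: its left modules are the `L`-`L`-bimodules over `ℂ`. -/
def Env (L : Type v) [DivisionRing L] [Algebra ℂ L] : Type v := L ⊗[ℂ] Lᵐᵒᵖ

noncomputable instance (L : Type v) [DivisionRing L] [Algebra ℂ L] : Ring (Env L) :=
  inferInstanceAs (Ring (L ⊗[ℂ] Lᵐᵒᵖ))

/-- The pure tensor `a ⊗ b`, which acts on a bimodule by `γ ↦ a · γ · b`. -/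
noncomputable def Env.tmul {L : Type v} [DivisionRing L] [Algebra ℂ L] (a b : L) : Env L :=
  (a ⊗ₜ[ℂ] MulOpposite.op b : L ⊗[ℂ] Lᵐᵒᵖ)

/-- The left multiplication `a · γ` in a bimodule. -/
noncomputable def lmul {L : Type v} [DivisionRing L] [Algebra ℂ L] {M : Type v} [AddCommGroup M]
    [Module (Env L) M] (a : L) (γ : M) : M :=
  Env.tmul a 1 • γ

/-- The right multiplication `γ · a` in a bimodule. -/
noncomputable def rmul {L : Type v} [DivisionRing L] [Algebra ℂ L] {M : Type v} [AddCommGroup M]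
    [Module (Env L) M] (γ : M) (a : L) : M :=
  Env.tmul 1 a • γ

/-- The free `L`-`L`-bimodule on the symbols `da`, `a ∈ L`. -/
abbrev FreeDiff (L : Type v) [DivisionRing L] [Algebra ℂ L] : Type v := L →₀ Env L

/-- The symbol `da` in the free bimodule. -/
noncomputable def freeD {L : Type v} [DivisionRing L] [Algebra ℂ L] (a : L) : FreeDiff L :=
  Finsupp.single a 1

variable {h : ℂ} {I : Type u} [LinearOrder I] {L : Type v} [DivisionRing L] [Algebra ℂ L]

/-- The defining relations of the differential module `L d_K L`, where `L` is generated over `Q_I`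
by the set `S` of central elements: linearity and Leibniz rule, vanishing of the differentials of
the constants `x_i, y_i` with `i ∉ K`, the commutation relations of the `x_i, y_i` with the
`dx_j, dy_j` for `j ∈ K`, and the commutation rules for the elements of `S`. -/
inductive DiffRel (ψ : CoordField h I →ₐ[ℂ] L) (K : Set I) (S : Set L) : FreeDiff L → Prop
  | linear (α β : ℂ) (a b : L) :
      DiffRel ψ K S (freeD (α • a + β • b) - lmul (algebraMap ℂ L α) (freeD a)
        - lmul (algebraMap ℂ L β) (freeD b))
  | leibniz (a b : L) :
      DiffRel ψ K S (freeD (a * b) - rmul (freeD a) b - lmul a (freeD b))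
  | one : DiffRel ψ K S (freeD 1)
  | const_x (i : I) (hi : i ∉ K) : DiffRel ψ K S (freeD (pt ψ i).1)
  | const_y (i : I) (hi : i ∉ K) : DiffRel ψ K S (freeD (pt ψ i).2)
  | dx_x (i j : I) (hj : j ∈ K) :
      DiffRel ψ K S (rmul (freeD (pt ψ j).1) (pt ψ i).1 - lmul (pt ψ i).1 (freeD (pt ψ j).1)
        + lmul (h • (pt ψ i).1) (freeD (pt ψ j).2) - lmul (h • (pt ψ i).2) (freeD (pt ψ j).1)
        - lmul (h ^ 2 • (pt ψ i).2) (freeD (pt ψ j).2))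
  | dx_y (i j : I) (hj : j ∈ K) :
      DiffRel ψ K S (rmul (freeD (pt ψ j).1) (pt ψ i).2 - lmul (pt ψ i).2 (freeD (pt ψ j).1)
        - lmul (h • (pt ψ i).2) (freeD (pt ψ j).2))
  | dy_y (i j : I) (hj : j ∈ K) :
      DiffRel ψ K S (rmul (freeD (pt ψ j).2) (pt ψ i).2 - lmul (pt ψ i).2 (freeD (pt ψ j).2))
  | dy_x (i j : I) (hj : j ∈ K) :
      DiffRel ψ K S (rmul (freeD (pt ψ j).2) (pt ψ i).1 - lmul (pt ψ i).1 (freeD (pt ψ j).2)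
        + lmul (h • (pt ψ i).2) (freeD (pt ψ j).2))
  | central_left (s a : L) (hs : s ∈ S) :
      DiffRel ψ K S (lmul s (freeD a) - rmul (freeD a) s)
  | central_right (s a : L) (hs : s ∈ S) :
      DiffRel ψ K S (lmul a (freeD s) - rmul (freeD s) a)

/-- The differential module `Γ = L d_K L`. -/
abbrev DiffModule (ψ : CoordField h I →ₐ[ℂ] L) (K : Set I) (S : Set L) : Type v :=
  FreeDiff L ⧸ Submodule.span (Env L) {ρ | DiffRel ψ K S ρ}

/-- The total differential `d_K : L → Γ`. -/
noncomputable def diff (ψ : CoordField h I →ₐ[ℂ] L) (K : Set I) (S : Set L) (a : L) :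
    DiffModule ψ K S :=
  Submodule.Quotient.mk (freeD a)

/-- The elliptic differential of the first kind `w⁻¹ (Y dX - X dY + h Y dY)` at the
point `p = (X, Y)`, where `w` is the chosen square root of `(X1)(X2)(X3)(X4)`. -/
noncomputable def ellipticDiff (ψ : CoordField h I →ₐ[ℂ] L) (K : Set I) (S : Set L)
    (w : L) (p : L × L) : DiffModule ψ K S :=
  lmul w⁻¹ (lmul p.2 (diff ψ K S p.1) - lmul p.1 (diff ψ K S p.2)
    + lmul (h • p.2) (diff ψ K S p.2))

end Differentials

end HDeformed

/-! The commutation relations make every bracket $(ij)$ commute with all coordinates, so brackets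
are central in $L$. The Plücker-type identity $(12)P = p_2\,(1P) - p_1\,(2P)$ then writes a pair $P$
whose brackets with the points $1$ and $2$ are central as $\alpha p_1+\beta p_2$ with $\alpha,\beta$
in the centre $Z$ of $L$. With $U=(01)$, $V=(02)$ and $p_j=a_jp_1+b_jp_2$, the form $r$ becomes the
binary cubic $UV(a_3U+b_3V)-(a_4U+b_4V)(a_5U+b_5V)^2$ over the commutative field $Z$, and
$(0P_i)=\alpha_iU+\beta_iV$. On the other side, $d$ restricted to $Z$ is a derivation whose values
commute with $L$ (`lmul_diff_center`), and
$de_{P_i}=w_i^{-1}(12)(\beta_i\,d\alpha_i-\alpha_i\,d\beta_i)$ (`ellipticDiff_combPt`).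

What remains is Abel's classical argument (`exists_signs_sum_eq_zero`). At a root of $r$ the
equation of the curve gives $w_i=\pm(12)^2(b_4\alpha_i-a_4\beta_i)(b_5\alpha_i-a_5\beta_i)$.
Differentiating $r=0$ there, where only $a_5,b_5$ vary, turns the elliptic differential into $\pm
2(\alpha_i\,db_5-\beta_i\,da_5)$ divided by $(12)\,C\prod_{j\ne
i}(\alpha_i\beta_j-\alpha_j\beta_i)$. The sum over the three roots vanishes by Euler's partial
fraction identity, since the numerator is linear in the root.

The noncommutative work is to justify the descent to $Z$, because $C$, $X_i$, $Y_i$ are not assumed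
central. The monomials $U^kV^{n-k}$ have to be independent over $Q_{I\setminus\{0\}}^T$
(`eq_zero_of_sum_subQAdjoin`). Over $Q_{I\setminus\{0\}}$ one clears denominators, which needs the
Ore condition (obtained from polynomial growth), and substitutes $p_a+c\,p_b$ for $p_0$ with
$c\in\mathbb C$. The passage to $T$ is a dimension count. Independence makes the brackets $(1P_i)$,
$(2P_i)$ central and permits comparison of coefficients. Finally, the roots are distinct because the
discriminant is nonzero in one explicit representation of $H_I$ (`abelDiscriminant_ne_zero`). -/

namespace HDeformed

universe u v

/-! ### Commutation relations of two points and the calculus of brackets. -/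

section PointRelations

/-- The bracket symbol of two pairs of elements of a `ℂ`-algebra. -/
def ringBracket {A : Type*} [Ring A] [Algebra ℂ A] (h : ℂ) (p q : A × A) : A :=
  p.1 * q.2 - p.2 * q.1 - h • (p.2 * q.2)

/-- The pairs `p` and `q` satisfy the commutation relations of two `h`-deformed points. -/
structure PointRel {A : Type*} [Ring A] [Algebra ℂ A] (h : ℂ) (p q : A × A) : Prop where
  xy : p.1 * q.2 = q.2 * p.1 + h • (p.2 * q.2)
  yx : q.1 * p.2 = p.2 * q.1 + h • (p.2 * q.2)
  yy : q.2 * p.2 = p.2 * q.2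
  xx : q.1 * p.1 = p.1 * q.1 - h • (q.2 * p.1) + h • (p.2 * q.1)

variable {A : Type*} [Ring A] [Algebra ℂ A] {h : ℂ} {p q r : A × A}

theorem bracket_eq_ringBracket {L : Type*} [DivisionRing L] [Algebra ℂ L] (p q : L × L) :
    bracket h p q = ringBracket h p q := rfl

namespace PointRel

/-- With the $y$-coordinates moved to the left the relations are invariant under exchange of the
points, so the order on the index set plays no further role. -/
theorem symm (H : PointRel h p q) : PointRel h q p where
  xy := by rw [H.yx, H.yy]
  yx := by rw [H.xy, H.yy]
  yy := H.yy.symm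
  xx := by rw [H.xx]; module

theorem ringBracket_eq (H : PointRel h p q) :
    ringBracket h p q = q.2 * p.1 - p.2 * q.1 := by
  rw [ringBracket, H.xy]; abel

theorem add_left {p' : A × A} (H : PointRel h p q) (H' : PointRel h p' q) :
    PointRel h (p + p') q where
  xy := by simp only [Prod.fst_add, Prod.snd_add, add_mul, mul_add, H.xy, H'.xy, smul_add]; abel
  yx := by simp only [Prod.snd_add, add_mul, mul_add, H.yx, H'.yx, smul_add]; abel
  yy := by simp only [Prod.snd_add, add_mul, mul_add, H.yy, H'.yy]
  xx := by
    simp only [Prod.fst_add, Prod.snd_add, add_mul, mul_add, H.xx, H'.xx, smul_add]; abel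

theorem smul_left (H : PointRel h p q) (c : ℂ) : PointRel h (c • p) q where
  xy := by simp only [Prod.smul_fst, Prod.smul_snd, smul_mul_assoc, mul_smul_comm, H.xy]; module
  yx := by simp only [Prod.smul_snd, smul_mul_assoc, mul_smul_comm, H.yx]; module
  yy := by simp only [Prod.smul_snd, smul_mul_assoc, mul_smul_comm, H.yy]
  xx := by simp only [Prod.smul_fst, Prod.smul_snd, smul_mul_assoc, mul_smul_comm, H.xx]; module

theorem add_right {q' : A × A} (H : PointRel h p q) (H' : PointRel h p q') :
    PointRel h p (q + q') :=
  (H.symm.add_left H'.symm).symm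

theorem smul_right (H : PointRel h p q) (c : ℂ) : PointRel h p (c • q) :=
  (H.symm.smul_left c).symm

theorem map {B : Type*} [Ring B] [Algebra ℂ B] (f : A →ₐ[ℂ] B) (H : PointRel h p q) :
    PointRel h (f p.1, f p.2) (f q.1, f q.2) where
  xy := by simp only [← map_mul, ← map_smul, ← map_add, H.xy]
  yx := by simp only [← map_mul, ← map_smul, ← map_add, H.yx]
  yy := by simp only [← map_mul, H.yy]
  xx := by simp only [← map_mul, ← map_smul, ← map_add, ← map_sub, H.xx]

/-- The `x`-coordinates of two points commute up to their bracket. -/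
theorem fst_mul_fst (H : PointRel h p q) :
    q.1 * p.1 = p.1 * q.1 - h • ringBracket h p q := by
  rw [H.ringBracket_eq, H.xx]; module

/-- Together with `ringBracket_mul_fst` this is the source of all centrality statements: the
corrections from moving $r$ past $p$ and past $q$ cancel. -/
theorem ringBracket_mul_snd (Hpq : PointRel h p q) (Hpr : PointRel h p r)
    (Hqr : PointRel h q r) : ringBracket h p q * r.2 = r.2 * ringBracket h p q := by
  rw [Hpq.ringBracket_eq, sub_mul, mul_sub, mul_assoc, mul_assoc, Hpr.xy, Hqr.xy]
  simp only [mul_add, mul_smul_comm, ← mul_assoc, Hpr.yy, Hqr.yy, Hpq.yy]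
  abel

theorem ringBracket_mul_fst (Hpq : PointRel h p q) (Hpr : PointRel h p r)
    (Hqr : PointRel h q r) : ringBracket h p q * r.1 = r.1 * ringBracket h p q := by
  rw [Hpq.ringBracket_eq, sub_mul, mul_sub, ← mul_assoc r.1, ← mul_assoc r.1, Hqr.yx, Hpr.yx,
    add_mul, add_mul, mul_assoc q.2 r.1, mul_assoc p.2 r.1, Hpr.xx, Hqr.xx]
  simp only [mul_add, mul_sub, mul_smul_comm, smul_mul_assoc, ← mul_assoc, Hpq.yy]
  abel

/-- The Plücker-type identity, which recovers $P$ from its brackets with $p$ and $q$. The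
coordinates of $P$ stay on the right throughout, so $P$ need not satisfy any relation. -/
theorem ringBracket_snd (H : PointRel h p q) (P : A × A) :
    q.2 * ringBracket h p P - p.2 * ringBracket h q P = ringBracket h p q * P.2 := by
  rw [H.ringBracket_eq]
  simp only [ringBracket, mul_sub, sub_mul, mul_smul_comm, ← mul_assoc, H.yy]
  abel

theorem ringBracket_fst (H : PointRel h p q) (P : A × A) :
    q.1 * ringBracket h p P - p.1 * ringBracket h q P = ringBracket h p q * P.1 := by
  rw [H.ringBracket_eq]
  simp only [ringBracket, mul_sub, sub_mul, mul_smul_comm, ← mul_assoc, H.yx, H.xy, H.xx, add_mul,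
    smul_mul_assoc, smul_add]
  module

theorem ringBracket_swap (H : PointRel h p q) : ringBracket h q p = - ringBracket h p q := by
  rw [H.ringBracket_eq, H.symm.ringBracket_eq]; abel

theorem ringBracket_self (H : PointRel h p p) : ringBracket h p p = 0 := by
  rw [H.ringBracket_eq, sub_self]

end PointRel

end PointRelations

/-! ### The generators of $H_I$ as points, and the universal property. -/

section CoordinatePoints

variable {h : ℂ} {I : Type u} [LinearOrder I]

/-- The pair `(x_i, y_i)` in `H_I`. -/
noncomputable def coordPt (h : ℂ) {I : Type u} [LinearOrder I] (i : I) :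
    CoordAlg h I × CoordAlg h I :=
  (coordX h i, coordY h i)

theorem pointRel_coordPt (i j : I) : PointRel h (coordPt h i) (coordPt h j) := by
  have key : ∀ {a b : FreeAlgebra ℂ (I ⊕ I)}, CoordRel h I a b →
      RingQuot.mkAlgHom ℂ (CoordRel h I) a = RingQuot.mkAlgHom ℂ (CoordRel h I) b :=
    fun hab => RingQuot.mkAlgHom_rel ℂ hab
  have lt : ∀ i j : I, i < j → PointRel h (coordPt h i) (coordPt h j) := by
    intro i j hij
    have h1 := key (CoordRel.xy (h := h) i j hij)
    have h2 := key (CoordRel.yx (h := h) i j hij)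
    have h3 := key (CoordRel.yy (h := h) i j hij)
    have h4 := key (CoordRel.xx (h := h) i j hij)
    simp only [map_mul, map_add, map_sub, map_smul] at h1 h2 h3 h4
    have h2' : coordX h i * coordY h j = coordY h j * coordX h i + h • (coordY h i * coordY h j) := by
      rw [coordX, coordY, coordY, h2]; abel
    refine ⟨h2', h1, h3, ?_⟩
    change coordX h j * coordX h i = coordX h i * coordX h j - h • (coordY h j * coordX h i)
      + h • (coordY h i * coordX h j)
    refine h4.trans ?_
    change coordX h i * coordX h j - h • (coordX h i * coordY h j)
      + h • (coordY h i * coordX h j) + h ^ 2 • (coordY h i * coordY h j) = _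
    rw [h2']; module
  rcases lt_trichotomy i j with hij | rfl | hij
  · exact lt i j hij
  · have h1 := key (CoordRel.xy_same (h := h) i)
    simp only [map_mul, map_add, map_smul] at h1
    exact ⟨h1, h1, rfl, by abel⟩
  · exact (lt j i hij).symm

/-- A family of points in a `ℂ`-algebra `A` satisfying the relations yields a homomorphism
`H_I → A`. -/
noncomputable def CoordAlg.lift {A : Type*} [Ring A] [Algebra ℂ A] (p : I → A × A)
    (hp : ∀ i j, PointRel h (p i) (p j)) : CoordAlg h I →ₐ[ℂ] A :=
  RingQuot.liftAlgHom ℂ ⟨FreeAlgebra.lift ℂ (Sum.elim (fun i => (p i).1) fun i => (p i).2), by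
    intro a b hab
    cases hab with
    | xy_same i => simpa using (hp i i).xy
    | xy i j hij => simpa using (hp i j).yx
    | yx i j hij => simp [(hp i j).xy]
    | yy i j hij => simpa using (hp i j).yy
    | xx i j hij =>
      simp only [map_mul, map_add, map_sub, map_smul, FreeAlgebra.lift_ι_apply, Sum.elim_inl,
        Sum.elim_inr, (hp i j).xx, (hp i j).xy]
      module⟩

@[simp] theorem CoordAlg.lift_coordX {A : Type*} [Ring A] [Algebra ℂ A] (p : I → A × A)
    (hp : ∀ i j, PointRel h (p i) (p j)) (i : I) :
    CoordAlg.lift p hp (coordX h i) = (p i).1 := by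
  simp [CoordAlg.lift, coordX]

@[simp] theorem CoordAlg.lift_coordY {A : Type*} [Ring A] [Algebra ℂ A] (p : I → A × A)
    (hp : ∀ i j, PointRel h (p i) (p j)) (i : I) :
    CoordAlg.lift p hp (coordY h i) = (p i).2 := by
  simp [CoordAlg.lift, coordY]

theorem map_ringBracket {A B : Type*} [Ring A] [Algebra ℂ A] [Ring B] [Algebra ℂ B]
    (f : A →ₐ[ℂ] B) (p q : A × A) :
    f (ringBracket h p q) = ringBracket h (f p.1, f p.2) (f q.1, f q.2) := by
  simp [ringBracket]

end CoordinatePoints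

/-! ### A representation in which all brackets are scalars. -/

section ShiftRepresentation

/-- The operator `f ↦ (n ↦ c f(n - 1))`. -/
def shiftY (c : ℂ) : Module.End ℂ (ℤ → ℂ) where
  toFun f n := c * f (n - 1)
  map_add' f g := by ext n; simp [mul_add]
  map_smul' a f := by ext n; simp; ring

/-- The operator `f ↦ (n ↦ h c (n - 1) f(n - 1) + d f(n + 1))`. -/
def shiftX (h d c : ℂ) : Module.End ℂ (ℤ → ℂ) where
  toFun f n := h * c * (n - 1) * f (n - 1) + d * f (n + 1)
  map_add' f g := by ext n; simp; ring
  map_smul' a f := by ext n; simp; ring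

/-- With $(Sf)(n)=f(n-1)$ and $(Nf)(n)=nf(n)$, the pair is $d\,(S^{-1},0)+c\,(hSN,S)$: every point
is a complex combination of two fixed points whose bracket is $1$. -/
theorem pointRel_shift (h d c d' c' : ℂ) :
    PointRel h (shiftX h d c, shiftY c) (shiftX h d' c', shiftY c') := by
  constructor <;>
  · ext f n
    simp [shiftX, shiftY]
    try ring_nf

theorem ringBracket_shift (h d c d' c' : ℂ) :
    ringBracket h (shiftX h d c, shiftY c) (shiftX h d' c', shiftY c')
      = algebraMap ℂ _ (d * c' - c * d') := by
  ext f n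
  simp [ringBracket, shiftX, shiftY]
  ring_nf

/-- The representation of `H_I` by shift operators with brackets `(ij)` acting as the scalars
`d_i c_j - c_i d_j`. -/
noncomputable def shiftRep (h : ℂ) {I : Type u} [LinearOrder I] (d c : I → ℂ) :
    CoordAlg h I →ₐ[ℂ] Module.End ℂ (ℤ → ℂ) :=
  CoordAlg.lift (fun i => (shiftX h (d i) (c i), shiftY (c i)))
    fun i j => pointRel_shift h (d i) (c i) (d j) (c j)

theorem shiftRep_ringBracket (h : ℂ) {I : Type u} [LinearOrder I] (d c : I → ℂ) (i j : I) :
    shiftRep h d c (ringBracket h (coordPt h i) (coordPt h j))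
      = algebraMap ℂ _ (d i * c j - c i * d j) := by
  rw [map_ringBracket]
  simp only [coordPt, shiftRep, CoordAlg.lift_coordX, CoordAlg.lift_coordY]
  exact ringBracket_shift h _ _ _ _

end ShiftRepresentation

/-! ### Polynomial growth and common left multiples. -/

section Growth

open Module

theorem exists_mul_add_one_pow_lt_two_pow (d e : ℕ) : ∃ k : ℕ, (k * d + 1) ^ e < 2 ^ k := by
  have h1 := tendsto_pow_const_div_const_pow_of_one_lt e (r := (2 : ℝ)) (by norm_num)
  have h2 : ∀ᶠ n : ℕ in Filter.atTop, (n : ℝ) ^ e / 2 ^ n < 1 / ((d : ℝ) + 1) ^ e :=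
    h1.eventually_lt_const (by positivity)
  obtain ⟨k, hk, hk1⟩ := (h2.and (Filter.eventually_ge_atTop 1)).exists
  refine ⟨k, ?_⟩
  rw [div_lt_div_iff₀ (by positivity) (by positivity), one_mul, ← mul_pow] at hk
  have h3 : (k * d + 1) ^ e ≤ (k * (d + 1)) ^ e := by
    gcongr
    nlinarith
  refine lt_of_le_of_lt h3 ?_
  exact_mod_cast hk

variable {K : Type*} {L : Type*} [Field K] [DivisionRing L] [Algebra K L]

/-- In an algebra of polynomial growth without zero divisors any two elements have a common left
multiple. -/
theorem exists_common_left_multiple (W : Submodule K L) [FiniteDimensional K W]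
    (e : ℕ) (hW : ∀ N, finrank K ↥(W ^ N) ≤ (N + 1) ^ e) {d : ℕ} {a b : L}
    (ha : a ∈ W ^ d) (hb : b ∈ W ^ d) (hb0 : b ≠ 0) :
    ∃ N, ∃ c ∈ W ^ N, ∃ c' ∈ W ^ N, c ≠ 0 ∧ c * a = c' * b := by
  -- Without a common left multiple, $W^Na$ and $W^Nb$ are independent inside $W^{N+d}$, so the
  -- dimension at least doubles every $d$ steps, against the polynomial bound.
  by_contra! hcon
  have hfin : ∀ N, FiniteDimensional K ↥(W ^ N) := fun N =>
    Module.Finite.iff_fg.2 ((Module.Finite.iff_fg.1 ‹FiniteDimensional K W›).pow N)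
  have hstep : ∀ N, 2 * finrank K ↥(W ^ N) ≤ finrank K ↥(W ^ (N + d)) := by
    intro N
    let f : (↥(W ^ N) × ↥(W ^ N)) →ₗ[K] ↥(W ^ (N + d)) :=
      LinearMap.codRestrict _
        ((LinearMap.mulRight K a ∘ₗ (W ^ N).subtype).coprod
          (-(LinearMap.mulRight K b ∘ₗ (W ^ N).subtype)))
        (by
          rintro ⟨c, c'⟩
          rw [pow_add]
          simpa using add_mem (Submodule.mul_mem_mul c.2 ha)
            (neg_mem (Submodule.mul_mem_mul c'.2 hb)))
    have hf : Function.Injective f := by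
      rw [← LinearMap.ker_eq_bot, LinearMap.ker_eq_bot']
      rintro ⟨⟨c, hc⟩, ⟨c', hc'⟩⟩ h0
      have h2 : c * a - c' * b = 0 := by
        have := congrArg Subtype.val h0
        simpa [f, sub_eq_add_neg] using this
      have hc0 : c = 0 := by
        by_contra hne
        exact hcon N c hc c' hc' hne (sub_eq_zero.1 h2)
      have hc0' : c' = 0 := by
        subst hc0
        simpa [hb0] using h2
      subst hc0 hc0'
      rfl
    have := LinearMap.finrank_le_finrank_of_injective hf
    rw [Module.finrank_prod] at this
    omega
  have hexp : ∀ k, 2 ^ k ≤ finrank K ↥(W ^ (k * d)) := by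
    intro k
    induction k with
    | zero =>
      have : (1 : L) ∈ W ^ (0 * d) := by simp
      rw [pow_zero, Nat.one_le_iff_ne_zero, ← Nat.pos_iff_ne_zero]
      have : Nontrivial ↥(W ^ (0 * d)) :=
        ⟨⟨⟨1, this⟩, 0, fun h => one_ne_zero (congrArg Subtype.val h)⟩⟩
      exact finrank_pos
    | succ k ih =>
      rw [pow_succ, add_mul, one_mul]
      exact le_trans (by omega) (hstep (k * d))
  obtain ⟨k, hk⟩ := exists_mul_add_one_pow_lt_two_pow d e
  exact absurd (lt_of_lt_of_le (lt_of_le_of_lt (hW (k * d)) hk) (hexp k)) (lt_irrefl _)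

/-- The span of the ordered monomials with exponents at most `N`. -/
def monomialSpan (K : Type*) {L : Type*} [Field K] [DivisionRing L] [Algebra K L]
    (y₁ y₂ x₁ x₂ : L) (N : ℕ) : Submodule K L :=
  Submodule.span K (Set.range fun m : Fin 4 → Fin (N + 1) =>
    y₁ ^ (m 0 : ℕ) * y₂ ^ (m 1 : ℕ) * x₁ ^ (m 2 : ℕ) * x₂ ^ (m 3 : ℕ))

theorem monomial_mem_monomialSpan (y₁ y₂ x₁ x₂ : L) {N a b c d : ℕ} (ha : a ≤ N) (hb : b ≤ N)
    (hc : c ≤ N) (hd : d ≤ N) :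
    y₁ ^ a * y₂ ^ b * x₁ ^ c * x₂ ^ d ∈ monomialSpan K y₁ y₂ x₁ x₂ N :=
  Submodule.subset_span ⟨![⟨a, by omega⟩, ⟨b, by omega⟩, ⟨c, by omega⟩, ⟨d, by omega⟩], by simp⟩

variable {y₁ y₂ x₁ x₂ : L} {η g : K}

theorem mul_pow_of_smul_comm {x y z : L} (h : x * y = y * x + η • (z * y)) (hzy : z * y = y * z)
    (n : ℕ) : x * y ^ n = y ^ n * x + (η * n) • (z * y ^ n) := by
  induction n with
  | zero => simp
  | succ n ih =>
    have hz : z * y ^ n = y ^ n * z := (show Commute z y from hzy).pow_right n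
    rw [pow_succ, ← mul_assoc, ih, add_mul, mul_assoc, h]
    simp only [mul_add, smul_mul_assoc, mul_smul_comm, ← mul_assoc, hz]
    push_cast
    module

/-- For `n = 0` the truncated exponent `n - 1` is harmless, since its coefficient vanishes. -/
theorem mul_pow_of_comm_scalar {x x' : L} (h : x * x' = x' * x + g • 1) (n : ℕ) :
    x * x' ^ n = x' ^ n * x + (g * n) • x' ^ (n - 1) := by
  induction n with
  | zero => simp
  | succ n ih =>
    rw [pow_succ, ← mul_assoc, ih, add_mul, mul_assoc, h]
    rcases n with _ | n
    · simp
    · simp only [mul_add, mul_smul_comm, smul_mul_assoc, ← mul_assoc, Nat.add_sub_cancel,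
        ← pow_succ, mul_one]
      push_cast
      module

/-- Each exchange of $x$ with a $y$ replaces $x$ by $z$, so the reordering does not raise the
degree. It is applied with $z$ the $y$-coordinate belonging to $x$. -/
theorem mul_pow_mul_pow_of_smul_comm {x z : L} (h₁ : x * y₁ = y₁ * x + η • (z * y₁))
    (h₂ : x * y₂ = y₂ * x + η • (z * y₂)) (hz₁ : z * y₁ = y₁ * z) (hz₂ : z * y₂ = y₂ * z)
    (a b : ℕ) (t : L) :
    x * (y₁ ^ a * y₂ ^ b * t)
      = y₁ ^ a * y₂ ^ b * (x * t) + (η * (a + b)) • (y₁ ^ a * y₂ ^ b * (z * t)) := by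
  have hza : z * y₁ ^ a = y₁ ^ a * z := (show Commute z y₁ from hz₁).pow_right a
  have hzb : z * y₂ ^ b = y₂ ^ b * z := (show Commute z y₂ from hz₂).pow_right b
  have e1 := mul_pow_of_smul_comm h₁ hz₁ a
  have e2 := mul_pow_of_smul_comm h₂ hz₂ b
  rw [hza] at e1
  rw [hzb] at e2
  rw [← mul_assoc, ← mul_assoc, e1, add_mul, mul_assoc (y₁ ^ a) x, e2]
  simp only [mul_add, add_mul, mul_smul_comm, smul_mul_assoc, ← mul_assoc]
  rw [mul_assoc (y₁ ^ a) z, hzb]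
  simp only [← mul_assoc]
  module

/-- Left multiplication by a generator raises each exponent of an ordered monomial by at most one
after reordering, so $W^N$ lies in the span of the $(N+1)^4$ ordered monomials with exponents at
most $N$. -/
theorem finrank_pow_le (hyy : y₁ * y₂ = y₂ * y₁)
    (h11 : x₁ * y₁ = y₁ * x₁ + η • (y₁ * y₁)) (h12 : x₁ * y₂ = y₂ * x₁ + η • (y₁ * y₂))
    (h21 : x₂ * y₁ = y₁ * x₂ + η • (y₂ * y₁)) (h22 : x₂ * y₂ = y₂ * x₂ + η • (y₂ * y₂))
    (hxx : x₂ * x₁ = x₁ * x₂ + g • 1) (N : ℕ) :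
    finrank K ↥((Submodule.span K {1, y₁, y₂, x₁, x₂}) ^ N) ≤ (N + 1) ^ 4 := by
  have hle : (Submodule.span K {1, y₁, y₂, x₁, x₂}) ^ N ≤ monomialSpan K y₁ y₂ x₁ x₂ N := by
    induction N with
    | zero =>
      rw [pow_zero, Submodule.one_le]
      simpa using monomial_mem_monomialSpan (K := K) y₁ y₂ x₁ x₂ (N := 0) le_rfl le_rfl le_rfl
        le_rfl
    | succ N ih =>
      rw [pow_succ']
      refine (mul_le_mul_right ih _).trans ?_
      rw [monomialSpan, Submodule.span_mul_span, Submodule.span_le]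
      rintro _ ⟨v, hv, _, ⟨m, rfl⟩, rfl⟩
      dsimp only
      generalize m 0 = a', m 1 = b', m 2 = c', m 3 = d'
      obtain ⟨a, ha⟩ := a'
      obtain ⟨b, hb⟩ := b'
      obtain ⟨c, hc⟩ := c'
      obtain ⟨d, hd⟩ := d'
      have mem : ∀ a' b' c' d', a' ≤ N + 1 → b' ≤ N + 1 → c' ≤ N + 1 → d' ≤ N + 1 →
          y₁ ^ a' * y₂ ^ b' * x₁ ^ c' * x₂ ^ d' ∈ monomialSpan K y₁ y₂ x₁ x₂ (N + 1) :=
        fun a' b' c' d' h1 h2 h3 h4 => monomial_mem_monomialSpan _ _ _ _ h1 h2 h3 h4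
      have hy1 : ∀ t, y₁ ^ a * y₂ ^ b * (y₁ * t) = y₁ ^ (a + 1) * y₂ ^ b * t := by
        intro t
        have : y₂ ^ b * y₁ = y₁ * y₂ ^ b := ((show Commute y₁ y₂ from hyy).pow_right b).symm
        rw [pow_succ, ← mul_assoc, mul_assoc (y₁ ^ a), this, ← mul_assoc]
      have hy2 : ∀ t, y₁ ^ a * y₂ ^ b * (y₂ * t) = y₁ ^ a * y₂ ^ (b + 1) * t := by
        intro t
        rw [pow_succ, ← mul_assoc, mul_assoc (y₁ ^ a)]
      simp only [SetLike.mem_coe]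
      rcases hv with rfl | rfl | rfl | rfl | rfl
      · simpa using mem a b c d (by omega) (by omega) (by omega) (by omega)
      · have := mem (a + 1) b c d (by omega) (by omega) (by omega) (by omega)
        simpa only [pow_succ', mul_assoc] using this
      · have := mem a (b + 1) c d (by omega) (by omega) (by omega) (by omega)
        rw [mul_assoc, ← hy2] at this
        have hc' : Commute v (y₁ ^ a) := (show Commute v y₁ from hyy.symm).pow_right a
        have hc'' : Commute v (v ^ b) := (Commute.refl v).pow_right b
        convert this using 1
        rw [mul_assoc _ (x₁ ^ c), ← mul_assoc, (hc'.mul_right hc'').eq, mul_assoc]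
      · rw [mul_assoc _ (v ^ c), mul_pow_mul_pow_of_smul_comm h11 h12 rfl hyy, hy1,
          ← mul_assoc v, ← pow_succ', ← mul_assoc, ← mul_assoc]
        exact add_mem (mem a b (c + 1) d (by omega) (by omega) (by omega) (by omega))
          (Submodule.smul_mem _ _ (mem (a + 1) b c d (by omega) (by omega) (by omega) (by omega)))
      · rw [mul_assoc _ (x₁ ^ c), mul_pow_mul_pow_of_smul_comm h21 h22 hyy.symm rfl, hy2,
          ← mul_assoc v, mul_pow_of_comm_scalar hxx, add_mul, mul_assoc _ v, ← pow_succ', mul_add,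
          smul_mul_assoc, mul_smul_comm, ← mul_assoc, ← mul_assoc, ← mul_assoc]
        exact add_mem (add_mem (mem a b c (d + 1) (by omega) (by omega) (by omega) (by omega))
          (Submodule.smul_mem _ _ (mem a b (c - 1) d (by omega) (by omega) (by omega) (by omega))))
          (Submodule.smul_mem _ _ (mem a (b + 1) c d (by omega) (by omega) (by omega) (by omega)))
  have hfin : FiniteDimensional K ↥(monomialSpan K y₁ y₂ x₁ x₂ N) :=
    FiniteDimensional.span_of_finite K (Set.finite_range _)
  refine (Submodule.finrank_mono hle).trans ((finrank_range_le_card _).trans ?_)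
  simp

end Growth

/-! ### Left fractions of an Ore subring. -/

section Fractions

variable {L : Type*} [DivisionRing L]

/-- Any two elements of the subring `R` have a common left multiple. -/
def IsLeftOre (R : Subring L) : Prop :=
  ∀ a ∈ R, ∀ b ∈ R, b ≠ 0 → ∃ c ∈ R, ∃ d ∈ R, c ≠ 0 ∧ c * a = d * b

/-- The skew field of left fractions of a left Ore subring of a skew field. -/
def IsLeftOre.fractions {R : Subring L} (hR : IsLeftOre R) : Subfield L where
  carrier := {x | ∃ s ∈ R, s ≠ 0 ∧ s * x ∈ R}
  mul_mem' := by
    rintro x x' ⟨s, hs, hs0, hx⟩ ⟨s', hs', hs0', hx'⟩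
    obtain ⟨c, hc, d, hd, hc0, e⟩ := hR _ hx _ hs' hs0'
    refine ⟨c * s, R.mul_mem hc hs, mul_ne_zero hc0 hs0, ?_⟩
    rw [mul_assoc, ← mul_assoc s, ← mul_assoc, e, mul_assoc]
    exact R.mul_mem hd hx'
  one_mem' := ⟨1, R.one_mem, one_ne_zero, by simp⟩
  add_mem' := by
    rintro x x' ⟨s, hs, hs0, hx⟩ ⟨s', hs', hs0', hx'⟩
    obtain ⟨c, hc, d, hd, hc0, e⟩ := hR _ hs _ hs' hs0'
    refine ⟨c * s, R.mul_mem hc hs, mul_ne_zero hc0 hs0, ?_⟩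
    rw [mul_add, mul_assoc, e, mul_assoc]
    exact R.add_mem (R.mul_mem hc hx) (R.mul_mem hd hx')
  zero_mem' := ⟨1, R.one_mem, one_ne_zero, by simp⟩
  neg_mem' := by
    rintro x ⟨s, hs, hs0, hx⟩
    exact ⟨s, hs, hs0, by simpa using hx⟩
  inv_mem' := by
    rintro x ⟨s, hs, hs0, hx⟩
    rcases eq_or_ne x 0 with rfl | h0
    · exact ⟨s, hs, hs0, by simp⟩
    · exact ⟨s * x, hx, mul_ne_zero hs0 h0, by rwa [mul_assoc, mul_inv_cancel₀ h0, mul_one]⟩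

theorem IsLeftOre.exists_common_denominator {R : Subring L} (hR : IsLeftOre R) {q : ℕ → L}
    (hq : ∀ k, q k ∈ hR.fractions) (n : ℕ) : ∃ s ∈ R, s ≠ 0 ∧ ∀ k < n, s * q k ∈ R := by
  induction n with
  | zero => exact ⟨1, R.one_mem, one_ne_zero, by simp⟩
  | succ n ih =>
    obtain ⟨s, hs, hs0, hsq⟩ := ih
    obtain ⟨t, ht, ht0, htq⟩ := hq n
    obtain ⟨c, hc, d, hd, hc0, e⟩ := hR _ hs _ ht ht0
    refine ⟨c * s, R.mul_mem hc hs, mul_ne_zero hc0 hs0, fun k hk => ?_⟩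
    rcases Nat.lt_succ_iff_lt_or_eq.1 hk with hk | rfl
    · rw [mul_assoc]; exact R.mul_mem hc (hsq k hk)
    · rw [e, mul_assoc]; exact R.mul_mem hd htq

end Fractions

/-! ### The Ore condition for the algebra generated by points. -/

section PointAlgebra

variable {L : Type*} [DivisionRing L]

theorem exists_denominator_of_mem_closure {R : Subring L} {κ : Subring.center L}
    (hκ : κ ∈ Subfield.closure {z : Subring.center L | (z : L) ∈ R}) :
    ∃ c : Subring.center L, c ≠ 0 ∧ (c : L) ∈ R ∧ (c : L) * κ ∈ R := by
  have hcl : Subring.closure {z : Subring.center L | (z : L) ∈ R}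
      ≤ R.comap (Subring.center L).subtype := Subring.closure_le.2 fun z hz => hz
  obtain ⟨y, hy, z, hz, rfl⟩ := Subfield.mem_closure_iff.1 hκ
  rcases eq_or_ne z 0 with rfl | hz0
  · exact ⟨1, one_ne_zero, R.one_mem, by simp⟩
  · refine ⟨z, hz0, hcl hz, ?_⟩
    have : (z : L) * ((y / z : Subring.center L) : L) = y := by
      rw [← Subring.coe_mul, mul_div_cancel₀ _ hz0]
    rw [this]
    exact hcl hy

section CentralField

variable {K : Type*} [Field K] [Algebra K L]

/-- The elements which have a denominator in `K ∩ R`, where `K` consists of fractions of elements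
of `K ∩ R`. -/
def centralLocalization (R : Subring L)
    (hK : ∀ κ : K, ∃ c : K, c ≠ 0 ∧ algebraMap K L c ∈ R ∧ c • algebraMap K L κ ∈ R) :
    Subalgebra K L where
  carrier := {v | ∃ c : K, c ≠ 0 ∧ algebraMap K L c ∈ R ∧ c • v ∈ R}
  mul_mem' := by
    rintro v v' ⟨c, hc0, hc, hv⟩ ⟨c', hc0', hc', hv'⟩
    refine ⟨c * c', mul_ne_zero hc0 hc0', ?_, ?_⟩
    · rw [map_mul]; exact R.mul_mem hc hc'
    · rw [← smul_mul_smul_comm]; exact R.mul_mem hv hv'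
  add_mem' := by
    rintro v v' ⟨c, hc0, hc, hv⟩ ⟨c', hc0', hc', hv'⟩
    refine ⟨c * c', mul_ne_zero hc0 hc0', ?_, ?_⟩
    · rw [map_mul]; exact R.mul_mem hc hc'
    · rw [smul_add, mul_smul c c' v', mul_comm, mul_smul c' c v, Algebra.smul_def c',
        Algebra.smul_def c (c' • v')]
      exact R.add_mem (R.mul_mem hc' hv) (R.mul_mem hc hv')
  algebraMap_mem' := hK

/-- The span of `1` and the coordinates of two points. -/
def coordSpan (K : Type*) [Field K] [Algebra K L] (p q : L × L) : Submodule K L :=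
  Submodule.span K {1, p.2, q.2, p.1, q.1}

theorem coordSpan_pow_le (R : Subring L)
    (hK : ∀ κ : K, ∃ c : K, c ≠ 0 ∧ algebraMap K L c ∈ R ∧ c • algebraMap K L κ ∈ R)
    {p q : L × L} (hp1 : p.1 ∈ R) (hp2 : p.2 ∈ R)
    (hq1 : q.1 ∈ R) (hq2 : q.2 ∈ R) (N : ℕ) :
    coordSpan K p q ^ N ≤ Subalgebra.toSubmodule (centralLocalization R hK) := by
  have hle : coordSpan K p q ≤ Subalgebra.toSubmodule (centralLocalization R hK) := by
    refine Submodule.span_le.2 ?_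
    have : ∀ v ∈ R, v ∈ centralLocalization R hK :=
      fun v hv => ⟨1, one_ne_zero, by simp [R.one_mem], by simpa⟩
    rintro v (rfl | rfl | rfl | rfl | rfl)
    · exact this _ R.one_mem
    · exact this _ hp2
    · exact this _ hq2
    · exact this _ hp1
    · exact this _ hq1
  induction N with
  | zero => rw [pow_zero]; exact Submodule.one_le.2 (centralLocalization R hK).one_mem
  | succ N ih =>
    rw [pow_succ]
    exact Submodule.mul_le.2 fun v hv v' hv' =>
      (centralLocalization R hK).mul_mem (ih hv) (hle hv')

theorem coordSpan_pow_mono (K : Type*) [Field K] [Algebra K L] (p q : L × L) {m n : ℕ}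
    (hmn : m ≤ n) : coordSpan K p q ^ m ≤ coordSpan K p q ^ n :=
  pow_le_pow_right₀ (Submodule.one_le.2 (Submodule.subset_span (by simp))) hmn

end CentralField

variable [Algebra ℂ L] {h : ℂ}

/-- The subalgebra generated by the coordinates of a family of points. -/
def pointAlgebra {ι : Type*} (p : ι → L × L) : Subalgebra ℂ L :=
  Algebra.adjoin ℂ (Set.range (fun i => (p i).1) ∪ Set.range fun i => (p i).2)

theorem fst_mem_pointAlgebra {ι : Type*} (p : ι → L × L) (i : ι) : (p i).1 ∈ pointAlgebra p :=
  Algebra.subset_adjoin (Or.inl ⟨i, rfl⟩)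

theorem snd_mem_pointAlgebra {ι : Type*} (p : ι → L × L) (i : ι) : (p i).2 ∈ pointAlgebra p :=
  Algebra.subset_adjoin (Or.inr ⟨i, rfl⟩)

theorem ringBracket_mem_pointAlgebra {ι : Type*} (p : ι → L × L) (i j : ι) :
    ringBracket h (p i) (p j) ∈ pointAlgebra p :=
  sub_mem (sub_mem (mul_mem (fst_mem_pointAlgebra p i) (snd_mem_pointAlgebra p j))
    (mul_mem (snd_mem_pointAlgebra p i) (fst_mem_pointAlgebra p j)))
    (Subalgebra.smul_mem _ (mul_mem (snd_mem_pointAlgebra p i) (snd_mem_pointAlgebra p j)) _)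

theorem algebraMap_mem_center (c : ℂ) : algebraMap ℂ L c ∈ Subring.center L :=
  Subring.mem_center_iff.2 fun g => (Algebra.commutes c g).symm

section CentralField

variable {K : Type*} [Field K] [Algebra K L]

/-- By the Plücker-type identity every point is a combination of $p_a$ and $p_b$ with coefficients
in $K$, so four coordinates suffice however large the index set is. -/
theorem exists_mem_coordSpan_pow {ι : Type*} (p : ι → L × L)
    (hp : ∀ i j, PointRel h (p i) (p j))
    (hK : ∀ z ∈ Subring.center L, z ∈ pointAlgebra p → ∃ κ : K, algebraMap K L κ = z)
    (hc : ∀ i j, ringBracket h (p i) (p j) ∈ Subring.center L) {a b : ι}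
    (hab : ringBracket h (p a) (p b) ≠ 0) {v : L} (hv : v ∈ pointAlgebra p) :
    ∃ N, v ∈ coordSpan K (p a) (p b) ^ N := by
  refine Algebra.adjoin_induction (p := fun v _ => ∃ N, v ∈ coordSpan K (p a) (p b) ^ N)
    ?_ ?_ ?_ ?_ hv
  · have key : ∀ (i : ι) (v va vb : L), va ∈ coordSpan K (p a) (p b) →
        vb ∈ coordSpan K (p a) (p b) →
        vb * ringBracket h (p a) (p i) - va * ringBracket h (p b) (p i)
          = ringBracket h (p a) (p b) * v →
        v ∈ coordSpan K (p a) (p b) ^ 1 := by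
      intro i v va vb hva hvb e
      rw [pow_one]
      obtain ⟨κ, hκ⟩ := hK _ (hc a b) (ringBracket_mem_pointAlgebra p a b)
      obtain ⟨κ₁, hκ₁⟩ := hK _ (hc a i) (ringBracket_mem_pointAlgebra p a i)
      obtain ⟨κ₂, hκ₂⟩ := hK _ (hc b i) (ringBracket_mem_pointAlgebra p b i)
      have hκ0 : κ ≠ 0 := by
        rintro rfl
        exact hab (by rw [← hκ, map_zero])
      have e' : v = κ⁻¹ • (κ₁ • vb - κ₂ • va) := by
        rw [eq_inv_smul_iff₀ hκ0, Algebra.smul_def, Algebra.smul_def, Algebra.smul_def, hκ, ← e,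
          ← hκ₁, ← hκ₂, Algebra.commutes, Algebra.commutes]
      rw [e']
      exact Submodule.smul_mem _ _ (Submodule.sub_mem _ (Submodule.smul_mem _ _ hvb)
        (Submodule.smul_mem _ _ hva))
    rintro v (⟨i, rfl⟩ | ⟨i, rfl⟩)
    · exact ⟨1, key i _ (p a).1 (p b).1 (Submodule.subset_span (by simp))
        (Submodule.subset_span (by simp)) ((hp a b).ringBracket_fst (p i))⟩
    · exact ⟨1, key i _ (p a).2 (p b).2 (Submodule.subset_span (by simp))
        (Submodule.subset_span (by simp)) ((hp a b).ringBracket_snd (p i))⟩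
  · intro c
    refine ⟨0, ?_⟩
    obtain ⟨κ, hκ⟩ := hK _ (algebraMap_mem_center c) ((pointAlgebra p).algebraMap_mem c)
    rw [pow_zero, ← hκ]
    exact Submodule.algebraMap_mem κ
  · rintro v v' - - ⟨N, hv⟩ ⟨N', hv'⟩
    exact ⟨max N N', Submodule.add_mem _ (coordSpan_pow_mono K _ _ (le_max_left _ _) hv)
      (coordSpan_pow_mono K _ _ (le_max_right _ _) hv')⟩
  · rintro v v' - - ⟨N, hv⟩ ⟨N', hv'⟩
    exact ⟨N + N', by rw [pow_add]; exact Submodule.mul_mem_mul hv hv'⟩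

/-- Over $K$ the algebra has growth of degree at most four, which gives a common left multiple with
coefficients in $K$. Their central denominators are then cleared. -/
theorem isLeftOre_of_centralField {ι : Type*} (p : ι → L × L)
    (hp : ∀ i j, PointRel h (p i) (p j))
    (hK : ∀ z ∈ Subring.center L, z ∈ pointAlgebra p → ∃ κ : K, algebraMap K L κ = z)
    (hK' : ∀ κ : K, ∃ c : K, c ≠ 0 ∧ algebraMap K L c ∈ (pointAlgebra p).toSubring ∧
      c • algebraMap K L κ ∈ (pointAlgebra p).toSubring)
    (hc : ∀ i j, ringBracket h (p i) (p j) ∈ Subring.center L) {a b : ι}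
    (hab : ringBracket h (p a) (p b) ≠ 0) : IsLeftOre (pointAlgebra p).toSubring := by
  intro u hu v hv hv0
  obtain ⟨N, hu'⟩ := exists_mem_coordSpan_pow p hp hK hc hab hu
  obtain ⟨N', hv'⟩ := exists_mem_coordSpan_pow p hp hK hc hab hv
  have hfin : FiniteDimensional K (coordSpan K (p a) (p b)) :=
    FiniteDimensional.span_of_finite K (by simp)
  obtain ⟨η, hη⟩ := hK _ (algebraMap_mem_center h) ((pointAlgebra p).algebraMap_mem h)
  obtain ⟨κ, hκ⟩ := hK _ (hc a b) (ringBracket_mem_pointAlgebra p a b)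
  have hη' : ∀ v : L, η • v = h • v := fun v => by rw [Algebra.smul_def, Algebra.smul_def, hη]
  have hrank : ∀ N, Module.finrank K ↥(coordSpan K (p a) (p b) ^ N) ≤ (N + 1) ^ 4 := by
    refine finrank_pow_le (η := η) (g := -(η * κ)) (hp a b).yy.symm ?_ ?_ ?_ ?_ ?_
    · rw [hη']; exact (hp a a).xy
    · rw [hη']; exact (hp a b).xy
    · rw [hη']; exact (hp a b).symm.xy
    · rw [hη']; exact (hp b b).xy
    · rw [neg_smul, mul_smul, hη', Algebra.smul_def κ, hκ, mul_one, (hp a b).fst_mul_fst,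
        sub_eq_add_neg]
  obtain ⟨M, c, hcM, d, hdM, hc0, e⟩ := exists_common_left_multiple _ 4 hrank
    (coordSpan_pow_mono K _ _ (le_max_left N N') hu')
    (coordSpan_pow_mono K _ _ (le_max_right N N') hv') hv0
  have hpow := coordSpan_pow_le (pointAlgebra p).toSubring hK' (fst_mem_pointAlgebra p a)
    (snd_mem_pointAlgebra p a) (fst_mem_pointAlgebra p b) (snd_mem_pointAlgebra p b) M
  obtain ⟨s, hs0, hsR, hsc⟩ := hpow hcM
  obtain ⟨t, ht0, htR, htd⟩ := hpow hdM
  refine ⟨algebraMap K L t * (s • c), Subring.mul_mem _ htR hsc, algebraMap K L s * (t • d),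
    Subring.mul_mem _ hsR htd, ?_, ?_⟩
  · rw [← Algebra.smul_def]
    exact smul_ne_zero ht0 (smul_ne_zero hs0 hc0)
  · rw [← Algebra.smul_def, ← Algebra.smul_def, smul_comm, smul_mul_assoc, smul_mul_assoc,
      smul_mul_assoc, smul_mul_assoc, e]

end CentralField

/-- The algebra generated by points with central brackets is a left Ore domain. -/
theorem isLeftOre_pointAlgebra {ι : Type*} (p : ι → L × L) (hp : ∀ i j, PointRel h (p i) (p j))
    (hc : ∀ i j, ringBracket h (p i) (p j) ∈ Subring.center L) {a b : ι}
    (hab : ringBracket h (p a) (p b) ≠ 0) : IsLeftOre (pointAlgebra p).toSubring := by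
  -- The whole centre of $L$ would be too large a scalar field: its elements need denominators lying
  -- in the point algebra.
  refine isLeftOre_of_centralField (K := Subfield.closure
    {z : Subring.center L | (z : L) ∈ (pointAlgebra p).toSubring}) p hp ?_ ?_ hc hab
  · exact fun z hz hzR => ⟨⟨⟨z, hz⟩, Subfield.subset_closure hzR⟩, rfl⟩
  · intro κ
    obtain ⟨c, hc0, hcR, hcκ⟩ := exists_denominator_of_mem_closure κ.2
    exact ⟨⟨c, Subfield.subset_closure hcR⟩, fun h0 => hc0 (congrArg Subtype.val h0), hcR, hcκ⟩

end PointAlgebra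

/-! ### $H_I$ inside $L$, and centrality of the brackets. -/

section Embedding

/-- The canonical map to the localization as an algebra homomorphism. -/
noncomputable def toQuotRingHom (R : Type u) [Ring R] [Algebra ℂ R] : R →ₐ[ℂ] QuotRing R where
  toFun := toQuotRing
  map_one' := by
    have := RingQuot.mkAlgHom_rel ℂ (FracRel.scalar (R := R) 1)
    simpa [toQuotRing] using this
  map_mul' a b := by
    have := RingQuot.mkAlgHom_rel ℂ (FracRel.mul a b)
    simpa [toQuotRing] using this
  map_zero' := by
    have := RingQuot.mkAlgHom_rel ℂ (FracRel.scalar (R := R) 0)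
    simpa [toQuotRing] using this
  map_add' a b := by
    have := RingQuot.mkAlgHom_rel ℂ (FracRel.add a b)
    simpa [toQuotRing] using this
  commutes' c := by
    have := RingQuot.mkAlgHom_rel ℂ (FracRel.scalar (R := R) c)
    simpa [toQuotRing] using this

theorem map_toQuotRing_ne_zero {R : Type u} [Ring R] [Algebra ℂ R] {A : Type*} [Ring A]
    [Nontrivial A] [Algebra ℂ A] (ψ : QuotRing R →ₐ[ℂ] A) {a : R} (ha : a ≠ 0) :
    ψ (toQuotRing a) ≠ 0 := by
  intro h0
  have := congrArg ψ (RingQuot.mkAlgHom_rel ℂ (FracRel.mul_inv (R := R) ⟨a, ha⟩))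
  rw [map_mul, map_mul, map_one, map_one] at this
  have h0' : ψ ((RingQuot.mkAlgHom ℂ (FracRel R)) (FreeAlgebra.ι ℂ (Sum.inl a))) = 0 := h0
  rw [h0', zero_mul] at this
  exact zero_ne_one this

variable {h : ℂ} {I : Type u} [LinearOrder I] {L : Type v} [DivisionRing L] [Algebra ℂ L]

/-- The restriction of `Q_I → L` to `H_I`. -/
noncomputable def coordHom (ψ : CoordField h I →ₐ[ℂ] L) : CoordAlg h I →ₐ[ℂ] L :=
  ψ.comp (toQuotRingHom (CoordAlg h I))

/-- A nonzero element becomes invertible in the localization, hence in $L$. The existence of $\psi$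
thus embeds $H_I$ without a separate proof that it is an Ore domain. -/
theorem coordHom_injective (ψ : CoordField h I →ₐ[ℂ] L) : Function.Injective (coordHom ψ) := by
  rw [injective_iff_map_eq_zero]
  intro a ha
  by_contra hne
  exact map_toQuotRing_ne_zero ψ hne ha

/-- Reduces nonvanishing in $L$ of an expression in the brackets to a computation with complex
numbers. -/
theorem coordHom_ne_zero (ψ : CoordField h I →ₐ[ℂ] L) {e : CoordAlg h I} {d c : I → ℂ} {s : ℂ}
    (he : shiftRep h d c e = algebraMap ℂ _ s) (hs : s ≠ 0) : coordHom ψ e ≠ 0 := by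
  rw [map_ne_zero_iff _ (coordHom_injective ψ)]
  rintro rfl
  rw [map_zero] at he
  have := congrArg (fun f : Module.End ℂ (ℤ → ℂ) => f 1 0) he
  simp at this
  exact hs this.symm

theorem pointRel_pt (ψ : CoordField h I →ₐ[ℂ] L) (i j : I) : PointRel h (pt ψ i) (pt ψ j) :=
  (pointRel_coordPt i j).map (coordHom ψ)

theorem coordHom_ringBracket (ψ : CoordField h I →ₐ[ℂ] L) (i j : I) :
    coordHom ψ (ringBracket h (coordPt h i) (coordPt h j)) = ringBracket h (pt ψ i) (pt ψ j) :=
  map_ringBracket _ _ _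

theorem ringBracket_pt_ne_zero (ψ : CoordField h I →ₐ[ℂ] L) {i j : I} (hij : i ≠ j) :
    ringBracket h (pt ψ i) (pt ψ j) ≠ 0 := by
  rw [← coordHom_ringBracket]
  -- Point $i$ goes to $(1,0)$ and point $j$ to $(0,1)$, so their bracket acts as $1$.
  refine coordHom_ne_zero ψ (d := fun k => if k = i then 1 else 0)
    (c := fun k => if k = j then 1 else 0) (shiftRep_ringBracket h _ _ i j) ?_
  simp [hij]

/-- A skew subfield containing the generators of `L` is everything. -/
theorem eq_top_of_generators_mem {ψ : CoordField h I →ₐ[ℂ] L} {S : Set L}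
    (hL : subQAdjoin ψ Set.univ S = ⊤) {F : Subfield L} (h0 : ∀ c : ℂ, algebraMap ℂ L c ∈ F)
    (h1 : ∀ i, (pt ψ i).1 ∈ F) (h2 : ∀ i, (pt ψ i).2 ∈ F) (h3 : ∀ s ∈ S, s ∈ F) : F = ⊤ := by
  rw [eq_top_iff, ← hL]
  refine Subfield.closure_le.2 (Set.union_subset (Subfield.closure_le.2 ?_) h3)
  rintro _ ((⟨c, rfl⟩ | ⟨i, -, rfl⟩) | ⟨i, -, rfl⟩)
  exacts [h0 c, h1 i, h2 i]

/-- The skew subfield of elements commuting with `z`. -/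
def elementCentralizer {L : Type*} [DivisionRing L] (z : L) : Subfield L where
  toSubring := Subring.centralizer {z}
  inv_mem' a ha := by
    simp only [Subsemiring.mem_carrier, Subring.mem_toSubsemiring,
      Subring.mem_centralizer_iff, Set.mem_singleton_iff, forall_eq] at ha ⊢
    exact (show Commute z a from ha).inv_right₀

theorem mem_elementCentralizer {L : Type*} [DivisionRing L] {z a : L} :
    a ∈ elementCentralizer z ↔ z * a = a * z := by
  change a ∈ Subring.centralizer {z} ↔ _
  simp [Subring.mem_centralizer_iff]

/-- An element commuting with generators of `L` is central. -/
theorem mem_center_of_commute {ψ : CoordField h I →ₐ[ℂ] L} {S : Set L}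
    (hL : subQAdjoin ψ Set.univ S = ⊤) (hS : S ⊆ Subring.center L) {z : L}
    (h1 : ∀ i, z * (pt ψ i).1 = (pt ψ i).1 * z) (h2 : ∀ i, z * (pt ψ i).2 = (pt ψ i).2 * z) :
    z ∈ Subring.center L := by
  have key : elementCentralizer z = ⊤ := eq_top_of_generators_mem hL
    (fun c => mem_elementCentralizer.2 (Algebra.commutes c z).symm)
    (fun i => mem_elementCentralizer.2 (h1 i)) (fun i => mem_elementCentralizer.2 (h2 i))
    (fun s hs => mem_elementCentralizer.2 (Subring.mem_center_iff.1 (hS hs) z))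
  refine Subring.mem_center_iff.2 fun g => ?_
  exact (mem_elementCentralizer.1 (key ▸ Subfield.mem_top g)).symm

theorem ringBracket_pt_mem_center {ψ : CoordField h I →ₐ[ℂ] L} {S : Set L}
    (hL : subQAdjoin ψ Set.univ S = ⊤) (hS : S ⊆ Subring.center L) (i j : I) :
    ringBracket h (pt ψ i) (pt ψ j) ∈ Subring.center L :=
  mem_center_of_commute hL hS
    (fun k => (pointRel_pt ψ i j).ringBracket_mul_fst (pointRel_pt ψ i k) (pointRel_pt ψ j k))
    (fun k => (pointRel_pt ψ i j).ringBracket_mul_snd (pointRel_pt ψ i k) (pointRel_pt ψ j k))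

end Embedding

/-! ### Independence of two linear forms over $Q_{I\setminus\{0\}}$. -/

section Independence

/-- Linear functionals reduce the claim to a complex polynomial that vanishes everywhere. -/
theorem eq_zero_of_forall_sum_pow_smul {M : Type*} [AddCommGroup M] [Module ℂ M] (v : ℕ → M)
    (n : ℕ) (hv : ∀ c : ℂ, ∑ k ∈ Finset.range n, c ^ k • v k = 0) {k : ℕ} (hk : k < n) :
    v k = 0 := by
  rw [← Module.forall_dual_apply_eq_zero_iff ℂ]
  intro f
  have h0 : ∑ k ∈ Finset.range n, Polynomial.monomial k (f (v k)) = 0 := by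
    refine Polynomial.funext fun c => ?_
    have := congrArg f (hv c)
    simpa [Polynomial.eval_finsetSum, mul_comm] using this
  have := congrArg (fun P => Polynomial.coeff P k) h0
  simpa [Polynomial.finsetSum_coeff, Polynomial.coeff_monomial, hk] using this

variable {h : ℂ} {I : Type u} [LinearOrder I] {L : Type v} [DivisionRing L] [Algebra ℂ L]

/-- The points obtained by replacing the point `o` by `a + c b`. -/
noncomputable def substPt (h : ℂ) (o a b : I) (c : ℂ) (i : I) : CoordAlg h I × CoordAlg h I :=
  if i = o then coordPt h a + c • coordPt h b else coordPt h i

theorem pointRel_substPt (o a b : I) (c : ℂ) (i j : I) :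
    PointRel h (substPt h o a b c i) (substPt h o a b c j) := by
  have key : ∀ i, PointRel h (coordPt h a + c • coordPt h b) (coordPt h i) := fun i =>
    (pointRel_coordPt a i).add_left ((pointRel_coordPt b i).smul_left c)
  unfold substPt
  split_ifs
  · exact (key a).add_right ((key b).smul_right c)
  · exact key j
  · exact (key i).symm
  · exact pointRel_coordPt i j

/-- The endomorphism of `H_I` replacing the point `o` by `a + c b`. -/
noncomputable def substHom (h : ℂ) (o a b : I) (c : ℂ) : CoordAlg h I →ₐ[ℂ] CoordAlg h I :=
  CoordAlg.lift (substPt h o a b c) (pointRel_substPt o a b c)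

theorem substHom_coordPt (o a b : I) (c : ℂ) (i : I) :
    (substHom h o a b c (coordPt h i).1, substHom h o a b c (coordPt h i).2)
      = substPt h o a b c i := by
  simp [substHom, coordPt]

theorem substHom_ringBracket (o a b : I) (c : ℂ) (i j : I) :
    substHom h o a b c (ringBracket h (coordPt h i) (coordPt h j))
      = ringBracket h (substPt h o a b c i) (substPt h o a b c j) := by
  rw [map_ringBracket, substHom_coordPt, substHom_coordPt]

theorem ringBracket_add_smul_left {A : Type*} [Ring A] [Algebra ℂ A] (p p' q : A × A) (c : ℂ) :
    ringBracket h (p + c • p') q = ringBracket h p q + c • ringBracket h p' q := by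
  simp only [ringBracket, Prod.fst_add, Prod.snd_add, Prod.smul_fst, Prod.smul_snd, add_mul,
    smul_mul_assoc]
  module

/-- Elements of `Q_{I \ {o}}` as fractions. -/
theorem subQ_compl_le_fractions (ψ : CoordField h I →ₐ[ℂ] L) (o : I)
    (hR : IsLeftOre (pointAlgebra fun j : {j : I // j ≠ o} => pt ψ j).toSubring) :
    subQ ψ {o}ᶜ ≤ hR.fractions := by
  have key : ∀ v ∈ pointAlgebra (fun j : {j : I // j ≠ o} => pt ψ j), v ∈ hR.fractions :=
    fun v hv => ⟨1, Subring.one_mem _, one_ne_zero, by simpa using hv⟩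
  refine Subfield.closure_le.2 ?_
  rintro _ ((⟨c, rfl⟩ | ⟨i, hi, rfl⟩) | ⟨i, hi, rfl⟩)
  · exact key _ (Subalgebra.algebraMap_mem _ c)
  · exact key _ (fst_mem_pointAlgebra (fun j : {j : I // j ≠ o} => pt ψ j) ⟨i, hi⟩)
  · exact key _ (snd_mem_pointAlgebra (fun j : {j : I // j ≠ o} => pt ψ j) ⟨i, hi⟩)

/-- Lifts of elements of the algebra of the points different from `o` to `H_I` that are invariant
under the substitutions of `o`. -/
theorem exists_lift_of_mem_pointAlgebra (ψ : CoordField h I →ₐ[ℂ] L) (o a b : I) {v : L}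
    (hv : v ∈ pointAlgebra fun j : {j : I // j ≠ o} => pt ψ j) :
    ∃ v' : CoordAlg h I, coordHom ψ v' = v ∧ ∀ c, substHom h o a b c v' = v' := by
  refine Algebra.adjoin_induction (p := fun v _ => ∃ v' : CoordAlg h I, coordHom ψ v' = v ∧
    ∀ c, substHom h o a b c v' = v') ?_ ?_ ?_ ?_ hv
  · rintro _ (⟨i, rfl⟩ | ⟨i, rfl⟩)
    · refine ⟨coordX h i, rfl, fun c => ?_⟩
      have := congrArg Prod.fst (substHom_coordPt (h := h) o a b c i)
      rwa [substPt, if_neg i.2] at this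
    · refine ⟨coordY h i, rfl, fun c => ?_⟩
      have := congrArg Prod.snd (substHom_coordPt (h := h) o a b c i)
      rwa [substPt, if_neg i.2] at this
  · exact fun c => ⟨algebraMap ℂ _ c, by simp, by simp⟩
  · rintro v w - - ⟨v', rfl, hv⟩ ⟨w', rfl, hw⟩
    exact ⟨v' + w', by simp, fun c => by simp [hv, hw]⟩
  · rintro v w - - ⟨v', rfl, hv⟩ ⟨w', rfl, hw⟩
    exact ⟨v' * w', by simp, fun c => by simp [hv, hw]⟩

/-- The forms `(oa)` and `(ob)` satisfy no homogeneous relation over `Q_{I \ {o}}`. -/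
theorem eq_zero_of_sum_subQ {ψ : CoordField h I →ₐ[ℂ] L} {S : Set L}
    (hL : subQAdjoin ψ Set.univ S = ⊤) (hS : S ⊆ Subring.center L) {o a b : I} (hao : a ≠ o)
    (hbo : b ≠ o) (hab : a ≠ b) (n : ℕ) {q : ℕ → L} (hq : ∀ k, q k ∈ subQ ψ {o}ᶜ)
    (h0 : ∑ k ∈ Finset.range (n + 1), q k * (ringBracket h (pt ψ o) (pt ψ a) ^ k
      * ringBracket h (pt ψ o) (pt ψ b) ^ (n - k)) = 0) {k : ℕ} (hk : k ≤ n) : q k = 0 := by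
  have hR : IsLeftOre (pointAlgebra fun j : {j : I // j ≠ o} => pt ψ j).toSubring :=
    isLeftOre_pointAlgebra (h := h) _ (fun i j => pointRel_pt ψ i j)
      (fun i j => ringBracket_pt_mem_center hL hS i j) (a := ⟨a, hao⟩) (b := ⟨b, hbo⟩)
      (ringBracket_pt_ne_zero ψ hab)
  -- The substitution used below is an endomorphism of $H_I$ only, so the relation must first be
  -- brought into $H_I$.
  obtain ⟨s, -, hs0, hsq⟩ := hR.exists_common_denominator
    (fun k => subQ_compl_le_fractions ψ o hR (hq k)) (n + 1)
  have hlift : ∀ k, ∃ v' : CoordAlg h I, k < n + 1 →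
      coordHom ψ v' = s * q k ∧ ∀ c, substHom h o a b c v' = v' := by
    intro k
    by_cases hk : k < n + 1
    · obtain ⟨v', hv'⟩ := exists_lift_of_mem_pointAlgebra ψ o a b (hsq k hk)
      exact ⟨v', fun _ => hv'⟩
    · exact ⟨0, fun hk' => absurd hk' hk⟩
  choose r hr using hlift
  have hrel : ∑ k ∈ Finset.range (n + 1), r k * (ringBracket h (coordPt h o) (coordPt h a) ^ k
      * ringBracket h (coordPt h o) (coordPt h b) ^ (n - k)) = 0 := by
    apply coordHom_injective ψ
    rw [map_zero, map_sum, ← mul_zero s, ← h0, Finset.mul_sum]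
    refine Finset.sum_congr rfl fun k hk => ?_
    rw [map_mul, map_mul, map_pow, map_pow, coordHom_ringBracket, coordHom_ringBracket,
      (hr k (Finset.mem_range.1 hk)).1, mul_assoc]
  set D := ringBracket h (coordPt h a) (coordPt h b) with hD
  -- Replacing $p_o$ by $p_a+c\,p_b$ sends $(oa)$ to $-cD$ and $(ob)$ to $D$ and fixes the
  -- coefficients, so the relation becomes a polynomial identity in $c$.
  have hvan : ∀ c : ℂ, ∑ k ∈ Finset.range (n + 1), c ^ k • (r k * ((-D) ^ k * D ^ (n - k))) = 0 := by
    intro c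
    rw [← map_zero (substHom h o a b c), ← hrel, map_sum]
    refine Finset.sum_congr rfl fun k hk => ?_
    rw [map_mul, map_mul, map_pow, map_pow, (hr k (Finset.mem_range.1 hk)).2,
      substHom_ringBracket, substHom_ringBracket, substPt, if_pos rfl, substPt, if_neg hao,
      substPt, if_neg hbo, ringBracket_add_smul_left, ringBracket_add_smul_left,
      (pointRel_coordPt a a).ringBracket_self, (pointRel_coordPt b b).ringBracket_self,
      (pointRel_coordPt a b).ringBracket_swap, zero_add, smul_zero, add_zero, smul_pow,
      smul_mul_assoc, mul_smul_comm]
  have hzero := eq_zero_of_forall_sum_pow_smul _ _ hvan (Nat.lt_succ_of_le hk)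
  have hD0 : coordHom ψ D ≠ 0 := by
    rw [hD, coordHom_ringBracket]
    exact ringBracket_pt_ne_zero ψ hab
  have := congrArg (coordHom ψ) hzero
  rw [map_mul, map_mul, map_pow, map_pow, map_neg, map_zero, (hr k (Nat.lt_succ_of_le hk)).1] at this
  simpa [hs0, hD0] using this

end Independence

/-! ### Independence of powers over a central algebraic extension. -/

section CentralExtension

variable {L : Type*} [DivisionRing L] (D : Subfield L)

/-- The elements of `D` which are central in `L`, as a subfield of the center. -/
def centralPart : Subfield (Subring.center L) := D.comap (Subring.center L).subtype

/-- The left `D`-span of a field of central elements. -/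
def centralSpan (K : IntermediateField (centralPart D) (Subring.center L)) : Submodule D L :=
  Submodule.span D ((Subring.center L).subtype '' (K : Set (Subring.center L)))

variable {D} {K K' : IntermediateField (centralPart D) (Subring.center L)}

theorem coe_mem_centralSpan {z : Subring.center L} (hz : z ∈ K) : (z : L) ∈ centralSpan D K :=
  Submodule.subset_span ⟨z, hz, rfl⟩

theorem centralSpan_mono (hK : K ≤ K') : centralSpan D K ≤ centralSpan D K' :=
  Submodule.span_mono (Set.image_mono hK)

theorem mem_centralSpan_of_mem {d : L} (hd : d ∈ D) : d ∈ centralSpan D K := by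
  have := Submodule.smul_mem _ (⟨d, hd⟩ : D) (coe_mem_centralSpan (D := D) (one_mem K))
  have e : (⟨d, hd⟩ : D) • ((1 : Subring.center L) : L) = d := mul_one d
  rwa [e] at this

theorem mul_mem_centralSpan {v w : L} (hv : v ∈ centralSpan D K) (hw : w ∈ centralSpan D K) :
    v * w ∈ centralSpan D K := by
  have hsmul : ∀ (d : D) (v : L), d • v = (d : L) * v := fun _ _ => rfl
  induction hv using Submodule.span_induction with
  | zero => simp
  | add v v' _ _ hv hv' => rw [add_mul]; exact add_mem hv hv'
  | smul d v _ hv => rw [hsmul, mul_assoc]; exact Submodule.smul_mem _ d hv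
  | mem v hv =>
    obtain ⟨z, hz, rfl⟩ := hv
    induction hw using Submodule.span_induction with
    | zero => simp
    | add v v' _ _ hv hv' => rw [mul_add]; exact add_mem hv hv'
    | smul d v _ hv =>
      rw [hsmul, Subring.subtype_apply, ← mul_assoc, ← Subring.mem_center_iff.1 z.2, mul_assoc]
      exact Submodule.smul_mem _ d hv
    | mem w hw =>
      obtain ⟨z', hz', rfl⟩ := hw
      rw [← map_mul]
      exact coe_mem_centralSpan (mul_mem hz hz')

theorem finite_centralSpan [FiniteDimensional (centralPart D) K] :
    Module.Finite D (centralSpan D K) := by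
  obtain ⟨s, hs⟩ := Module.Finite.fg_top (R := centralPart D) (M := K)
  refine Module.Finite.iff_fg.2 ?_
  have e : centralSpan D K =
      Submodule.span D ((fun z : K => ((z : Subring.center L) : L)) '' s) := by
    refine le_antisymm (Submodule.span_le.2 ?_) (Submodule.span_mono ?_)
    · rintro _ ⟨z, hz, rfl⟩
      have hz' : (⟨z, hz⟩ : K) ∈ Submodule.span (centralPart D) (s : Set K) :=
        hs ▸ Submodule.mem_top
      change (((⟨z, hz⟩ : K) : Subring.center L) : L) ∈ _
      generalize (⟨z, hz⟩ : K) = x at hz'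
      induction hz' using Submodule.span_induction with
      | zero => exact zero_mem _
      | add x y _ _ hx hy => exact add_mem hx hy
      | smul c x _ hx =>
        exact Submodule.smul_mem _ (⟨((c : Subring.center L) : L), c.2⟩ : D) hx
      | mem x hx => exact Submodule.subset_span ⟨x, hx, rfl⟩
    · rintro _ ⟨z, -, rfl⟩
      exact ⟨z, z.2, rfl⟩
  rw [e]
  exact Submodule.fg_span (s.finite_toSet.image _)

/-- Right multiplication by $v \ne 0$ is an injective left $D$-linear endomorphism of a
finite-dimensional space, hence surjective, and $1$ has a preimage. -/
theorem inv_mem_centralSpan [FiniteDimensional (centralPart D) K] {v : L}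
    (hv : v ∈ centralSpan D K) : v⁻¹ ∈ centralSpan D K := by
  rcases eq_or_ne v 0 with rfl | h0
  · simp
  have := finite_centralSpan (D := D) (K := K)
  let f : centralSpan D K →ₗ[D] centralSpan D K :=
    { toFun := fun w => ⟨w * v, mul_mem_centralSpan w.2 hv⟩
      map_add' := fun w w' => Subtype.ext (add_mul _ _ _)
      map_smul' := fun d w => Subtype.ext (mul_assoc (d : L) w v) }
  have hf : Function.Injective f := fun w w' e =>
    Subtype.ext (mul_right_cancel₀ h0 (congrArg Subtype.val e))
  obtain ⟨w, hw⟩ := LinearMap.injective_iff_surjective.1 hf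
    ⟨1, coe_mem_centralSpan (D := D) (one_mem K)⟩
  have hw' : (w : L) * v = 1 := congrArg Subtype.val hw
  rw [← eq_inv_of_mul_eq_one_left hw']
  exact w.2

/-- The spans $DK$ for finite central $K$ are closed under all skew field operations and are
directed, so together they exhaust the extension generated by $T$. -/
theorem exists_mem_centralSpan {T : Set L}
    (hT : ∀ σ ∈ T, ∃ σ' : Subring.center L, (σ' : L) = σ ∧ IsAlgebraic (centralPart D) σ') {v : L}
    (hv : v ∈ Subfield.closure (D ∪ T)) :
    ∃ K : IntermediateField (centralPart D) (Subring.center L),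
      FiniteDimensional (centralPart D) K ∧ v ∈ centralSpan D K := by
  induction hv using Subfield.closure_induction with
  | mem v hv =>
    rcases hv with hv | hv
    · exact ⟨⊥, inferInstance, mem_centralSpan_of_mem hv⟩
    · obtain ⟨σ, rfl, hσ⟩ := hT v hv
      exact ⟨IntermediateField.adjoin _ {σ},
        IntermediateField.adjoin.finiteDimensional hσ.isIntegral,
        coe_mem_centralSpan (IntermediateField.mem_adjoin_simple_self _ σ)⟩
  | one => exact ⟨⊥, inferInstance, mem_centralSpan_of_mem (one_mem D)⟩
  | add v w _ _ hv hw =>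
    obtain ⟨K, hK, hv⟩ := hv
    obtain ⟨K', hK', hw⟩ := hw
    exact ⟨K ⊔ K', inferInstance,
      add_mem (centralSpan_mono le_sup_left hv) (centralSpan_mono le_sup_right hw)⟩
  | neg v _ hv =>
    obtain ⟨K, hK, hv⟩ := hv
    exact ⟨K, hK, neg_mem hv⟩
  | inv v _ hv =>
    obtain ⟨K, hK, hv⟩ := hv
    exact ⟨K, hK, inv_mem_centralSpan hv⟩
  | mul v w _ _ hv hw =>
    obtain ⟨K, hK, hv⟩ := hv
    obtain ⟨K', hK', hw⟩ := hw
    exact ⟨K ⊔ K', inferInstance,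
      mul_mem_centralSpan (centralSpan_mono le_sup_left hv) (centralSpan_mono le_sup_right hw)⟩

theorem exists_forall_mem_centralSpan {T : Set L}
    (hT : ∀ σ ∈ T, ∃ σ' : Subring.center L, (σ' : L) = σ ∧ IsAlgebraic (centralPart D) σ')
    {f : ℕ → L} (hf : ∀ k, f k ∈ Subfield.closure (D ∪ T)) (n : ℕ) :
    ∃ K : IntermediateField (centralPart D) (Subring.center L),
      FiniteDimensional (centralPart D) K ∧ ∀ k < n, f k ∈ centralSpan D K := by
  induction n with
  | zero => exact ⟨⊥, inferInstance, by simp⟩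
  | succ n ih =>
    obtain ⟨K, hK, hv⟩ := ih
    obtain ⟨K', hK', hw⟩ := exists_mem_centralSpan hT (hf n)
    refine ⟨K ⊔ K', inferInstance, fun k hk => ?_⟩
    rcases Nat.lt_succ_iff_lt_or_eq.1 hk with hk | rfl
    · exact centralSpan_mono le_sup_left (hv k hk)
    · exact centralSpan_mono le_sup_right hw

/-- A central element whose powers are independent over `D` has independent powers over a central
algebraic extension of `D`. -/
theorem eq_zero_of_sum_pow_eq_zero {t : L}
    (hind : LinearIndependent D fun k : ℕ => t ^ k) {T : Set L}
    (hT : ∀ σ ∈ T, ∃ σ' : Subring.center L, (σ' : L) = σ ∧ IsAlgebraic (centralPart D) σ')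
    {f : ℕ → L} (hf : ∀ k, f k ∈ Subfield.closure (D ∪ T)) (n : ℕ)
    (h0 : ∑ k ∈ Finset.range n, f k * t ^ k = 0) : ∀ k < n, f k = 0 := by
  induction n with
  | zero => simp
  | succ n ih =>
    rw [Finset.sum_range_succ] at h0
    by_cases hn : f n = 0
    · rw [hn, zero_mul, add_zero] at h0
      intro k hk
      rcases Nat.lt_succ_iff_lt_or_eq.1 hk with hk | rfl
      · exact ih h0 k hk
      · exact hn
    exfalso
    -- A nonzero leading coefficient expresses $t^n$ through lower powers over $DK$. All powers of
    -- $t$ then lie in a finite-dimensional left $D$-space, contrary to their independence over $D$.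
    obtain ⟨K, hK, hfK⟩ := exists_forall_mem_centralSpan hT hf (n + 1)
    have hfin := finite_centralSpan (D := D) (K := K)
    let g : (Fin n → centralSpan D K) →ₗ[D] L :=
      { toFun := fun e => ∑ k, (e k : L) * t ^ (k : ℕ)
        map_add' := fun e e' => by simp [add_mul, Finset.sum_add_distrib]
        map_smul' := fun d e => by
          rw [RingHom.id_apply, Finset.smul_sum]
          exact Finset.sum_congr rfl fun k _ => mul_assoc (d : L) _ _ }
    have hlt : ∀ e ∈ centralSpan D K, ∀ k < n, e * t ^ k ∈ LinearMap.range g := by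
      intro e he k hk
      refine ⟨Pi.single ⟨k, hk⟩ ⟨e, he⟩, ?_⟩
      change ∑ j : Fin n, _ = _
      rw [Finset.sum_eq_single ⟨k, hk⟩]
      · simp
      · intro j _ hj
        rw [Pi.single_eq_of_ne hj]
        simp
      · simp
    have htop : t ^ n = ∑ k ∈ Finset.range n, (-((f n)⁻¹ * f k)) * t ^ k := by
      rw [add_comm, add_eq_zero_iff_eq_neg] at h0
      rw [← inv_mul_cancel_left₀ hn (t ^ n), h0, mul_neg, Finset.mul_sum, ← Finset.sum_neg_distrib]
      exact Finset.sum_congr rfl fun k _ => by rw [neg_mul, mul_assoc]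
    have hle : ∀ e ∈ centralSpan D K, ∀ k ≤ n, e * t ^ k ∈ LinearMap.range g := by
      intro e he k hk
      rcases hk.lt_or_eq with hk | rfl
      · exact hlt e he k hk
      · rw [htop, Finset.mul_sum]
        refine sum_mem fun j hj => ?_
        rw [← mul_assoc]
        have hj' := Finset.mem_range.1 hj
        exact hlt _ (mul_mem_centralSpan he (neg_mem (mul_mem_centralSpan
          (inv_mem_centralSpan (hfK _ (by omega))) (hfK _ (by omega))))) j hj'
    have hpow : ∀ k, t ^ k ∈ LinearMap.range g := by
      intro k
      induction k with
      | zero => simpa using hle 1 (mem_centralSpan_of_mem (one_mem D)) 0 (Nat.zero_le _)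
      | succ k ihk =>
        obtain ⟨e, he⟩ := ihk
        have he' : ∑ j, (e j : L) * t ^ (j : ℕ) = t ^ k := he
        rw [pow_succ, ← he', Finset.sum_mul]
        refine sum_mem fun j _ => ?_
        rw [mul_assoc, ← pow_succ]
        exact hle _ (e j).2 _ j.2
    have hind' : LinearIndependent D fun k : ℕ => (⟨t ^ k, hpow k⟩ : LinearMap.range g) :=
      LinearIndependent.of_comp (LinearMap.range g).subtype hind
    have := hind'.finite
    exact not_finite ℕ

end CentralExtension

/-! ### Independence over $Q_{I\setminus\{0\}}^T$. -/

section Independence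

variable {h : ℂ} {I : Type u} [LinearOrder I] {L : Type v} [DivisionRing L] [Algebra ℂ L]

theorem IsCentralAlgebraic.exists_isAlgebraic {ψ : CoordField h I →ₐ[ℂ] L} {J : Set I} {T : Set L}
    (hT : IsCentralAlgebraic ψ J T) : ∀ σ ∈ T, ∃ σ' : Subring.center L,
      (σ' : L) = σ ∧ IsAlgebraic (centralPart (subQ ψ J)) σ' := by
  intro σ hσ
  obtain ⟨hc, P, hP0, hP, hPσ⟩ := hT σ hσ
  refine ⟨⟨σ, hc⟩, rfl, ?_⟩
  let j : centralPart (subQ ψ J) →+* L :=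
    (Subring.center L).subtype.comp (centralPart (subQ ψ J)).subtype
  have hlift : P ∈ Polynomial.lifts j := by
    rw [Polynomial.lifts_iff_coeff_lifts]
    exact fun n => ⟨⟨⟨P.coeff n, (hP n).2⟩, (hP n).1⟩, rfl⟩
  obtain ⟨p, rfl⟩ := (Polynomial.mem_lifts P).1 hlift
  refine ⟨p, fun h0 => hP0 (by rw [h0, Polynomial.map_zero]), ?_⟩
  apply Subtype.ext
  rw [Polynomial.eval_map] at hPσ
  have := Polynomial.hom_eval₂ p (algebraMap _ (Subring.center L)) (Subring.center L).subtype
    ⟨σ, hc⟩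
  exact this.trans hPσ

/-- The forms `(oa)` and `(ob)` satisfy no homogeneous relation over a central algebraic extension
of `Q_{I \ {o}}`. -/
theorem eq_zero_of_sum_subQAdjoin {ψ : CoordField h I →ₐ[ℂ] L} {S : Set L}
    (hL : subQAdjoin ψ Set.univ S = ⊤) (hS : S ⊆ Subring.center L) {o a b : I} (hao : a ≠ o)
    (hbo : b ≠ o) (hab : a ≠ b) {T : Set L} (hT : IsCentralAlgebraic ψ {o}ᶜ T) (n : ℕ)
    {f : ℕ → L} (hf : ∀ k ≤ n, f k ∈ subQAdjoin ψ {o}ᶜ T)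
    (h0 : ∑ k ∈ Finset.range (n + 1), f k * (ringBracket h (pt ψ o) (pt ψ a) ^ k
      * ringBracket h (pt ψ o) (pt ψ b) ^ (n - k)) = 0) {k : ℕ} (hk : k ≤ n) : f k = 0 := by
  set U := ringBracket h (pt ψ o) (pt ψ a) with hU
  set V := ringBracket h (pt ψ o) (pt ψ b) with hV
  have hUc : U ∈ Subring.center L := ringBracket_pt_mem_center hL hS o a
  have hV0 : V ≠ 0 := ringBracket_pt_ne_zero ψ hbo.symm
  have hUV : Commute U V⁻¹ := (Subring.mem_center_iff.1 hUc _).symm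
  -- Dehomogenization: a homogeneous relation between $U$ and $V$ is a polynomial relation for
  -- $t=UV^{-1}$.
  have hmon : ∀ {n k}, k < n + 1 → U ^ k * V ^ (n - k) = (U * V⁻¹) ^ k * V ^ n := by
    intro n k hk
    rw [hUV.mul_pow, mul_assoc]
    congr 1
    obtain ⟨m, rfl⟩ := Nat.exists_eq_add_of_le (Nat.le_of_lt_succ hk)
    rw [Nat.add_sub_cancel_left, pow_add, inv_pow, inv_mul_cancel_left₀ (pow_ne_zero _ hV0)]
  have hsum : ∀ (n) (q : ℕ → L), ∑ k ∈ Finset.range (n + 1), q k * (U ^ k * V ^ (n - k))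
      = (∑ k ∈ Finset.range (n + 1), q k * (U * V⁻¹) ^ k) * V ^ n := by
    intro n q
    rw [Finset.sum_mul]
    exact Finset.sum_congr rfl fun k hk => by rw [hmon (Finset.mem_range.1 hk), mul_assoc]
  have hind : LinearIndependent (subQ ψ {o}ᶜ) fun k : ℕ => (U * V⁻¹) ^ k := by
    rw [linearIndependent_iff'']
    intro s g hg hs k
    by_contra hk
    have hks : k ∈ s := by
      by_contra hks
      exact hk (hg k hks)
    obtain ⟨n, hn⟩ := s.exists_nat_subset_range
    refine hk (Subtype.ext ?_)
    refine eq_zero_of_sum_subQ hL hS hao hbo hab n (q := fun k => (g k : L)) (fun k => (g k).2) ?_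
      (Finset.mem_range.1 (hn hks)).le
    rw [← hU, ← hV, hsum]
    have : ∑ k ∈ Finset.range (n + 1), (g k : L) * (U * V⁻¹) ^ k = 0 := by
      rw [← hs]
      refine (Finset.sum_subset (hn.trans (Finset.range_subset_range.2 (Nat.le_succ n))) ?_).symm
      intro j _ hj
      rw [hg j hj]
      simp
    rw [this, zero_mul]
  rw [hsum] at h0
  have h0' := (mul_eq_zero.1 h0).resolve_right (pow_ne_zero _ hV0)
  -- Coefficients beyond `n` are set to zero, since the lemma requires every `f k` to lie in the
  -- extension.
  have := eq_zero_of_sum_pow_eq_zero hind hT.exists_isAlgebraic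
    (f := fun k => if k ≤ n then f k else 0) ?_ (n + 1) ?_ k (Nat.lt_succ_of_le hk)
  · simpa [hk] using this
  · intro k
    split_ifs with hk
    · exact hf k hk
    · exact zero_mem _
  · rw [← h0']
    exact Finset.sum_congr rfl fun k hk => by
      rw [if_pos (Nat.le_of_lt_succ (Finset.mem_range.1 hk))]

end Independence

/-! ### Calculus in bimodules over $L$. -/

section Bimodule

variable {L : Type v} [DivisionRing L] [Algebra ℂ L] {M : Type v} [AddCommGroup M]
  [Module (Env L) M]

theorem Env.tmul_mul_tmul (a b a' b' : L) :
    Env.tmul a b * Env.tmul a' b' = Env.tmul (a * a') (b' * b) :=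
  Algebra.TensorProduct.tmul_mul_tmul a a' (MulOpposite.op b) (MulOpposite.op b')

theorem lmul_mul (a b : L) (γ : M) : lmul (a * b) γ = lmul a (lmul b γ) := by
  rw [lmul, lmul, lmul, ← mul_smul, Env.tmul_mul_tmul, mul_one]

theorem rmul_mul (a b : L) (γ : M) : rmul γ (a * b) = rmul (rmul γ a) b := by
  rw [rmul, rmul, rmul, ← mul_smul, Env.tmul_mul_tmul, mul_one]

theorem rmul_lmul (a b : L) (γ : M) : rmul (lmul a γ) b = lmul a (rmul γ b) := by
  rw [rmul, lmul, lmul, rmul, ← mul_smul, ← mul_smul, Env.tmul_mul_tmul, Env.tmul_mul_tmul,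
    one_mul, mul_one, one_mul, mul_one]

@[simp] theorem one_lmul (γ : M) : lmul (1 : L) γ = γ := one_smul (Env L) γ

@[simp] theorem rmul_one (γ : M) : rmul γ (1 : L) = γ := one_smul (Env L) γ

theorem add_lmul (a b : L) (γ : M) : lmul (a + b) γ = lmul a γ + lmul b γ := by
  rw [lmul, lmul, lmul, ← add_smul]
  exact congrArg (· • γ) (TensorProduct.add_tmul a b (MulOpposite.op (1 : L)))

theorem rmul_add (a b : L) (γ : M) : rmul γ (a + b) = rmul γ a + rmul γ b := by
  rw [rmul, rmul, rmul, ← add_smul]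
  exact congrArg (· • γ) (TensorProduct.tmul_add (1 : L) (MulOpposite.op a) (MulOpposite.op b))

@[simp] theorem lmul_zero (a : L) : lmul a (0 : M) = 0 := smul_zero _

@[simp] theorem zero_rmul (a : L) : rmul (0 : M) a = 0 := smul_zero _

theorem lmul_add (a : L) (γ γ' : M) : lmul a (γ + γ') = lmul a γ + lmul a γ' := smul_add _ _ _

theorem add_rmul (a : L) (γ γ' : M) : rmul (γ + γ') a = rmul γ a + rmul γ' a := smul_add _ _ _

theorem lmul_sub (a : L) (γ γ' : M) : lmul a (γ - γ') = lmul a γ - lmul a γ' := smul_sub _ _ _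

theorem sub_rmul (a : L) (γ γ' : M) : rmul (γ - γ') a = rmul γ a - rmul γ' a := smul_sub _ _ _

theorem lmul_neg (a : L) (γ : M) : lmul a (-γ) = -lmul a γ := smul_neg _ _

/-- The ring homomorphism describing the left multiplication. -/
noncomputable def lmulHom (L : Type v) [DivisionRing L] [Algebra ℂ L] : L →+* Env L where
  toFun a := Env.tmul a 1
  map_one' := rfl
  map_mul' a b := by rw [Env.tmul_mul_tmul, mul_one]
  map_zero' := TensorProduct.zero_tmul _ (MulOpposite.op (1 : L))
  map_add' a b := TensorProduct.add_tmul a b (MulOpposite.op (1 : L))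

@[simp] theorem zero_lmul (γ : M) : lmul (0 : L) γ = 0 := by
  change lmulHom L 0 • γ = 0
  rw [map_zero, zero_smul]

theorem neg_lmul (a : L) (γ : M) : lmul (-a) γ = -lmul a γ := by
  change lmulHom L (-a) • γ = -(lmulHom L a • γ)
  rw [map_neg, neg_smul]

theorem sub_lmul (a b : L) (γ : M) : lmul (a - b) γ = lmul a γ - lmul b γ := by
  change lmulHom L (a - b) • γ = lmulHom L a • γ - lmulHom L b • γ
  rw [map_sub, sub_smul]

@[simp] theorem rmul_zero (γ : M) : rmul γ (0 : L) = 0 := by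
  have := rmul_add (0 : L) 0 γ
  rwa [add_zero, left_eq_add] at this

theorem rmul_neg (a : L) (γ : M) : rmul γ (-a) = -rmul γ a := by
  rw [eq_neg_iff_add_eq_zero, ← rmul_add, neg_add_cancel, rmul_zero]

theorem lmul_algebraMap (c : ℂ) (γ : M) :
    lmul (algebraMap ℂ L c) γ = rmul γ (algebraMap ℂ L c) := by
  have e : Env.tmul (algebraMap ℂ L c) 1 = Env.tmul (1 : L) (algebraMap ℂ L c) := by
    change (algebraMap ℂ L c ⊗ₜ[ℂ] MulOpposite.op 1 : L ⊗[ℂ] Lᵐᵒᵖ)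
      = 1 ⊗ₜ[ℂ] MulOpposite.op (algebraMap ℂ L c)
    rw [Algebra.algebraMap_eq_smul_one, TensorProduct.smul_tmul, MulOpposite.op_smul]
  rw [lmul, rmul, e]

theorem lmul_inv_cancel {a : L} (ha : a ≠ 0) (γ : M) : lmul a⁻¹ (lmul a γ) = γ := by
  rw [← lmul_mul, inv_mul_cancel₀ ha, one_lmul]

/-- The skew subfield of the elements commuting with the element `γ` of a bimodule. -/
noncomputable def bimoduleCentralizer (γ : M) : Subfield L where
  carrier := {a | lmul a γ = rmul γ a}
  mul_mem' := by
    intro a b (ha : lmul a γ = rmul γ a) (hb : lmul b γ = rmul γ b)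
    change lmul (a * b) γ = rmul γ (a * b)
    rw [lmul_mul, hb, ← rmul_lmul, ha, rmul_mul]
  one_mem' := by
    change lmul (1 : L) γ = rmul γ 1
    simp
  add_mem' := by
    intro a b (ha : lmul a γ = rmul γ a) (hb : lmul b γ = rmul γ b)
    change lmul (a + b) γ = rmul γ (a + b)
    rw [add_lmul, rmul_add, ha, hb]
  zero_mem' := by
    change lmul (0 : L) γ = rmul γ 0
    simp
  neg_mem' := by
    intro a (ha : lmul a γ = rmul γ a)
    change lmul (-a) γ = rmul γ (-a)
    rw [neg_lmul, rmul_neg, ha]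
  inv_mem' := by
    intro a (ha : lmul a γ = rmul γ a)
    change lmul a⁻¹ γ = rmul γ a⁻¹
    rcases eq_or_ne a 0 with rfl | h0
    · simp
    · have e : lmul a⁻¹ (rmul (lmul a γ) a⁻¹) = rmul γ a⁻¹ := by
        rw [← rmul_lmul, lmul_inv_cancel h0]
      rwa [ha, ← rmul_mul, mul_inv_cancel₀ h0, rmul_one] at e

theorem mem_bimoduleCentralizer {γ : M} {a : L} :
    a ∈ bimoduleCentralizer γ ↔ lmul a γ = rmul γ a := Iff.rfl

end Bimodule

/-! ### Differentials, and $d$ as a derivation on the centre. -/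

section Differentials

variable {h : ℂ} {I : Type u} [LinearOrder I] {L : Type v} [DivisionRing L] [Algebra ℂ L]
  {ψ : CoordField h I →ₐ[ℂ] L} {K : Set I} {S : Set L}

theorem mk_eq_zero_of_diffRel {ρ : FreeDiff L} (hρ : DiffRel ψ K S ρ) :
    (Submodule.Quotient.mk ρ : DiffModule ψ K S) = 0 :=
  (Submodule.Quotient.mk_eq_zero _).2 (Submodule.subset_span hρ)

theorem diff_linear (α β : ℂ) (a b : L) :
    diff ψ K S (α • a + β • b)
      = lmul (algebraMap ℂ L α) (diff ψ K S a) + lmul (algebraMap ℂ L β) (diff ψ K S b) := by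
  have := mk_eq_zero_of_diffRel (DiffRel.linear (ψ := ψ) (K := K) (S := S) α β a b)
  rw [Submodule.Quotient.mk_sub, Submodule.Quotient.mk_sub, sub_sub, sub_eq_zero] at this
  exact this

theorem diff_add (a b : L) : diff ψ K S (a + b) = diff ψ K S a + diff ψ K S b := by
  have := diff_linear (ψ := ψ) (K := K) (S := S) 1 1 a b
  simpa using this

theorem diff_mul (a b : L) :
    diff ψ K S (a * b) = rmul (diff ψ K S a) b + lmul a (diff ψ K S b) := by
  have := mk_eq_zero_of_diffRel (DiffRel.leibniz (ψ := ψ) (K := K) (S := S) a b)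
  rw [Submodule.Quotient.mk_sub, Submodule.Quotient.mk_sub, sub_sub, sub_eq_zero] at this
  exact this

theorem diff_one : diff ψ K S 1 = 0 := mk_eq_zero_of_diffRel DiffRel.one

theorem diff_algebraMap (c : ℂ) : diff ψ K S (algebraMap ℂ L c) = 0 := by
  have := diff_linear (ψ := ψ) (K := K) (S := S) c 0 1 1
  simpa [diff_one, Algebra.algebraMap_eq_smul_one] using this

@[simp] theorem diff_zero : diff ψ K S 0 = 0 := by
  simpa using diff_algebraMap (ψ := ψ) (K := K) (S := S) 0

theorem diff_neg (a : L) : diff ψ K S (-a) = -diff ψ K S a := by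
  rw [eq_neg_iff_add_eq_zero, ← diff_add, neg_add_cancel, diff_zero]

theorem diff_fst_eq_zero {i : I} (hi : i ∉ K) : diff ψ K S (pt ψ i).1 = 0 :=
  mk_eq_zero_of_diffRel (DiffRel.const_x i hi)

theorem diff_snd_eq_zero {i : I} (hi : i ∉ K) : diff ψ K S (pt ψ i).2 = 0 :=
  mk_eq_zero_of_diffRel (DiffRel.const_y i hi)

theorem diff_fst_rmul_fst (i : I) {j : I} (hj : j ∈ K) :
    rmul (diff ψ K S (pt ψ j).1) (pt ψ i).1
      = lmul ((pt ψ i).1 + h • (pt ψ i).2) (diff ψ K S (pt ψ j).1)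
        + lmul (h ^ 2 • (pt ψ i).2 - h • (pt ψ i).1) (diff ψ K S (pt ψ j).2) := by
  have := mk_eq_zero_of_diffRel (DiffRel.dx_x (ψ := ψ) (K := K) (S := S) i j hj)
  simp only [Submodule.Quotient.mk_sub, Submodule.Quotient.mk_add] at this
  change rmul (diff ψ K S (pt ψ j).1) (pt ψ i).1 - lmul (pt ψ i).1 (diff ψ K S (pt ψ j).1)
        + lmul (h • (pt ψ i).1) (diff ψ K S (pt ψ j).2)
        - lmul (h • (pt ψ i).2) (diff ψ K S (pt ψ j).1)
        - lmul (h ^ 2 • (pt ψ i).2) (diff ψ K S (pt ψ j).2) = 0 at this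
  rw [add_lmul, sub_lmul, ← sub_eq_zero, ← this]
  abel

theorem diff_fst_rmul_snd (i : I) {j : I} (hj : j ∈ K) :
    rmul (diff ψ K S (pt ψ j).1) (pt ψ i).2
      = lmul (pt ψ i).2 (diff ψ K S (pt ψ j).1)
        + lmul (h • (pt ψ i).2) (diff ψ K S (pt ψ j).2) := by
  have := mk_eq_zero_of_diffRel (DiffRel.dx_y (ψ := ψ) (K := K) (S := S) i j hj)
  simp only [Submodule.Quotient.mk_sub] at this
  change rmul (diff ψ K S (pt ψ j).1) (pt ψ i).2 - lmul (pt ψ i).2 (diff ψ K S (pt ψ j).1)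
        - lmul (h • (pt ψ i).2) (diff ψ K S (pt ψ j).2) = 0 at this
  rw [← sub_eq_zero, ← this]
  abel

theorem diff_snd_rmul_snd (i : I) {j : I} (hj : j ∈ K) :
    rmul (diff ψ K S (pt ψ j).2) (pt ψ i).2 = lmul (pt ψ i).2 (diff ψ K S (pt ψ j).2) := by
  have := mk_eq_zero_of_diffRel (DiffRel.dy_y (ψ := ψ) (K := K) (S := S) i j hj)
  rw [Submodule.Quotient.mk_sub, sub_eq_zero] at this
  exact this

theorem diff_snd_rmul_fst (i : I) {j : I} (hj : j ∈ K) :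
    rmul (diff ψ K S (pt ψ j).2) (pt ψ i).1
      = lmul ((pt ψ i).1 - h • (pt ψ i).2) (diff ψ K S (pt ψ j).2) := by
  have := mk_eq_zero_of_diffRel (DiffRel.dy_x (ψ := ψ) (K := K) (S := S) i j hj)
  simp only [Submodule.Quotient.mk_sub, Submodule.Quotient.mk_add] at this
  change rmul (diff ψ K S (pt ψ j).2) (pt ψ i).1 - lmul (pt ψ i).1 (diff ψ K S (pt ψ j).2)
        + lmul (h • (pt ψ i).2) (diff ψ K S (pt ψ j).2) = 0 at this
  rw [sub_lmul, ← sub_eq_zero, ← this]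
  abel

theorem lmul_diff_of_mem {s : L} (hs : s ∈ S) (a : L) :
    lmul s (diff ψ K S a) = rmul (diff ψ K S a) s := by
  have := mk_eq_zero_of_diffRel (DiffRel.central_left (ψ := ψ) (K := K) (S := S) s a hs)
  rw [Submodule.Quotient.mk_sub, sub_eq_zero] at this
  exact this

/-- The bracket of the point `k` with the pair of differentials `(dx_j, dy_j)`. -/
noncomputable def diffBracket (ψ : CoordField h I →ₐ[ℂ] L) (K : Set I) (S : Set L) (k j : I) :
    DiffModule ψ K S :=
  lmul ((pt ψ k).1 - h • (pt ψ k).2) (diff ψ K S (pt ψ j).2)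
    - lmul (pt ψ k).2 (diff ψ K S (pt ψ j).1)

/-- The analogue of `ringBracket_mul_snd`: the corrections from moving $y_i$ past the differentials
and past the point $k$ cancel. -/
theorem diffBracket_rmul_snd (i k : I) {j : I} (hj : j ∈ K) :
    rmul (diffBracket ψ K S k j) (pt ψ i).2 = lmul (pt ψ i).2 (diffBracket ψ K S k j) := by
  have H := pointRel_pt ψ k i
  rw [diffBracket, sub_rmul, rmul_lmul, rmul_lmul, diff_snd_rmul_snd i hj, diff_fst_rmul_snd i hj]
  simp only [lmul_add, lmul_sub, ← lmul_mul]
  have e1 : (pt ψ k).2 * (pt ψ i).2 = (pt ψ i).2 * (pt ψ k).2 := H.yy.symm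
  have e2 : ((pt ψ k).1 - h • (pt ψ k).2) * (pt ψ i).2 - (pt ψ k).2 * (h • (pt ψ i).2)
      = (pt ψ i).2 * ((pt ψ k).1 - h • (pt ψ k).2) := by
    simp only [sub_mul, mul_sub, smul_mul_assoc, mul_smul_comm, H.xy, H.yy]
    abel
  rw [← e2, sub_lmul, e1]
  abel

theorem diffBracket_rmul_fst (i k : I) {j : I} (hj : j ∈ K) :
    rmul (diffBracket ψ K S k j) (pt ψ i).1 = lmul (pt ψ i).1 (diffBracket ψ K S k j) := by
  have H := pointRel_pt ψ k i
  rw [diffBracket, sub_rmul, rmul_lmul, rmul_lmul, diff_snd_rmul_fst i hj, diff_fst_rmul_fst i hj]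
  simp only [lmul_add, lmul_sub, ← lmul_mul]
  have e1 : (pt ψ k).2 * ((pt ψ i).1 + h • (pt ψ i).2) = (pt ψ i).1 * (pt ψ k).2 := by
    rw [H.yx, mul_add, mul_smul_comm]
  have e2 : ((pt ψ k).1 - h • (pt ψ k).2) * ((pt ψ i).1 - h • (pt ψ i).2)
        - (pt ψ k).2 * (h ^ 2 • (pt ψ i).2 - h • (pt ψ i).1)
      = (pt ψ i).1 * ((pt ψ k).1 - h • (pt ψ k).2) := by
    simp only [sub_mul, mul_sub, smul_mul_assoc, mul_smul_comm, H.xx, H.yx, H.xy, smul_sub,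
      smul_add]
    module
  rw [← e2, sub_lmul, e1]
  abel

/-- The elements commuting with a fixed bimodule element form a skew subfield, so testing the
generators of $L$ is enough. -/
theorem bimoduleCentralizer_diffBracket (hL : subQAdjoin ψ Set.univ S = ⊤)
    (hS : S ⊆ Subring.center L) (k : I) {j : I} (hj : j ∈ K) :
    bimoduleCentralizer (L := L) (diffBracket ψ K S k j) = ⊤ := by
  refine eq_top_of_generators_mem hL (fun c => lmul_algebraMap c _)
    (fun i => (diffBracket_rmul_fst i k hj).symm) (fun i => (diffBracket_rmul_snd i k hj).symm) ?_
  intro s hs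
  rw [mem_bimoduleCentralizer, diffBracket, lmul_sub, sub_rmul, rmul_lmul, rmul_lmul, ← lmul_mul,
    ← lmul_mul, ← lmul_diff_of_mem hs, ← lmul_diff_of_mem hs, ← lmul_mul, ← lmul_mul,
    Subring.mem_center_iff.1 (hS hs), Subring.mem_center_iff.1 (hS hs)]

/-- The differentials of the coordinates in terms of central brackets. -/
theorem ringBracket_lmul_diff (a b j : I) :
    lmul (ringBracket h (pt ψ a) (pt ψ b)) (diff ψ K S (pt ψ j).1)
        = lmul (pt ψ b).1 (diffBracket ψ K S a j) - lmul (pt ψ a).1 (diffBracket ψ K S b j) ∧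
      lmul (ringBracket h (pt ψ a) (pt ψ b)) (diff ψ K S (pt ψ j).2)
        = lmul (pt ψ b).2 (diffBracket ψ K S a j)
          - lmul (pt ψ a).2 (diffBracket ψ K S b j) := by
  have H := pointRel_pt ψ a b
  have e1 : (pt ψ b).2 * ((pt ψ a).1 - h • (pt ψ a).2)
      - (pt ψ a).2 * ((pt ψ b).1 - h • (pt ψ b).2) = ringBracket h (pt ψ a) (pt ψ b) := by
    rw [H.ringBracket_eq]
    simp only [mul_sub, mul_smul_comm, H.yy]
    abel
  have e2 : (pt ψ a).1 * (pt ψ b).2 - (pt ψ b).1 * (pt ψ a).2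
      = ringBracket h (pt ψ a) (pt ψ b) := by
    rw [H.ringBracket_eq, H.yx, H.xy]
    abel
  have e3 : (pt ψ b).1 * ((pt ψ a).1 - h • (pt ψ a).2)
      - (pt ψ a).1 * ((pt ψ b).1 - h • (pt ψ b).2) = 0 := by
    simp only [mul_sub, mul_smul_comm, H.xx, H.yx, H.xy, smul_add]
    module
  constructor
  · simp only [diffBracket, lmul_sub, ← lmul_mul]
    rw [← sub_eq_zero, ← e2, sub_lmul]
    have := congrArg (fun c => lmul c (diff ψ K S (pt ψ j).2)) e3
    simp only [sub_lmul, zero_lmul] at this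
    rw [← neg_eq_zero, ← this]
    abel
  · simp only [diffBracket, lmul_sub, ← lmul_mul]
    rw [← e1, sub_lmul, H.yy]
    abel

/-- Central elements of `L` commute with all differentials. -/
theorem lmul_diff_of_mem_center (hL : subQAdjoin ψ Set.univ S = ⊤)
    (hS : S ⊆ Subring.center L) {a b : I} (hab : a ≠ b) {f : L} (hf : f ∈ Subring.center L)
    (v : L) : lmul f (diff ψ K S v) = rmul (diff ψ K S v) f := by
  have hfc : ∀ c : L, c * f = f * c := fun c => Subring.mem_center_iff.1 hf c
  let F : Subfield L :=
    { carrier := {v | lmul f (diff ψ K S v) = rmul (diff ψ K S v) f}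
      mul_mem' := by
        intro v w (hv : lmul f (diff ψ K S v) = _) (hw : lmul f (diff ψ K S w) = _)
        change lmul f (diff ψ K S (v * w)) = rmul (diff ψ K S (v * w)) f
        rw [diff_mul, lmul_add, add_rmul, ← rmul_lmul, hv, rmul_lmul, ← hw, ← lmul_mul, ← lmul_mul,
          hfc, ← rmul_mul, ← rmul_mul, hfc]
      one_mem' := by
        change lmul f (diff ψ K S 1) = rmul (diff ψ K S 1) f
        simp [diff_one]
      add_mem' := by
        intro v w (hv : lmul f (diff ψ K S v) = _) (hw : lmul f (diff ψ K S w) = _)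
        change lmul f (diff ψ K S (v + w)) = rmul (diff ψ K S (v + w)) f
        rw [diff_add, lmul_add, add_rmul, hv, hw]
      zero_mem' := by
        change lmul f (diff ψ K S 0) = rmul (diff ψ K S 0) f
        simp
      neg_mem' := by
        intro v (hv : lmul f (diff ψ K S v) = _)
        change lmul f (diff ψ K S (-v)) = rmul (diff ψ K S (-v)) f
        rw [diff_neg, lmul_neg, hv]
        exact (smul_neg _ _).symm
      inv_mem' := by
        intro v (hv : lmul f (diff ψ K S v) = _)
        change lmul f (diff ψ K S v⁻¹) = rmul (diff ψ K S v⁻¹) f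
        rcases eq_or_ne v 0 with rfl | h0
        · simp
        have e : diff ψ K S v⁻¹ = -lmul v⁻¹ (rmul (diff ψ K S v) v⁻¹) := by
          have := diff_mul (ψ := ψ) (K := K) (S := S) v v⁻¹
          rw [mul_inv_cancel₀ h0, diff_one, eq_comm, add_eq_zero_iff_neg_eq] at this
          rw [← lmul_inv_cancel h0 (diff ψ K S v⁻¹), ← this, lmul_neg]
        rw [e, lmul_neg, ← lmul_mul, ← hfc, lmul_mul, ← rmul_lmul, hv, ← rmul_mul, ← hfc, rmul_mul,
          ← rmul_lmul]
        exact (smul_neg _ _).symm }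
  have key : F = ⊤ := by
    -- The relations of $\Gamma$ mention only generators, not an arbitrary central $f$. But $dx_j$
    -- and $dy_j$ are left combinations of brackets that commute with all of $L$, so $f$ passes
    -- through them.
    have hcoord : ∀ (j : I), j ∈ K → ∀ (u v : L) (γ : DiffModule ψ K S),
        lmul (ringBracket h (pt ψ a) (pt ψ b)) γ
          = lmul u (diffBracket ψ K S a j) - lmul v (diffBracket ψ K S b j) →
        lmul f γ = rmul γ f := by
      intro j hj u v γ hγ
      have hD := ringBracket_pt_ne_zero ψ hab
      have hcomm : ∀ k, rmul (diffBracket ψ K S k j) f = lmul f (diffBracket ψ K S k j) := by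
        intro k
        have : f ∈ bimoduleCentralizer (L := L) (diffBracket ψ K S k j) := by
          rw [bimoduleCentralizer_diffBracket hL hS k hj]
          exact Subfield.mem_top f
        exact (mem_bimoduleCentralizer.1 this).symm
      rw [← lmul_inv_cancel hD γ, hγ]
      simp only [lmul_sub, sub_rmul, rmul_lmul, hcomm, ← lmul_mul]
      simp only [hfc]
    refine eq_top_of_generators_mem hL ?_ ?_ ?_ ?_
    · intro c
      change lmul f (diff ψ K S _) = rmul (diff ψ K S _) f
      simp [diff_algebraMap]
    · intro i
      change lmul f (diff ψ K S _) = rmul (diff ψ K S _) f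
      by_cases hi : i ∈ K
      · exact hcoord i hi _ _ _ (ringBracket_lmul_diff a b i).1
      · simp [diff_fst_eq_zero hi]
    · intro i
      change lmul f (diff ψ K S _) = rmul (diff ψ K S _) f
      by_cases hi : i ∈ K
      · exact hcoord i hi _ _ _ (ringBracket_lmul_diff a b i).2
      · simp [diff_snd_eq_zero hi]
    · intro s hs
      change lmul f (diff ψ K S s) = rmul (diff ψ K S s) f
      have := mk_eq_zero_of_diffRel (DiffRel.central_right (ψ := ψ) (K := K) (S := S) s f hs)
      rw [Submodule.Quotient.mk_sub, sub_eq_zero] at this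
      exact this
  have hv : v ∈ F := key.symm ▸ Subfield.mem_top v
  exact hv

/-- The differentials of central elements commute with all elements of `L`. -/
theorem lmul_diff_center (hL : subQAdjoin ψ Set.univ S = ⊤)
    (hS : S ⊆ Subring.center L) {a b : I} (hab : a ≠ b) {f : L} (hf : f ∈ Subring.center L)
    (v : L) : lmul v (diff ψ K S f) = rmul (diff ψ K S f) v := by
  -- Expand $d(vf)=d(fv)$ and cancel $f\,dv=dv\cdot f$.
  have h1 := diff_mul (ψ := ψ) (K := K) (S := S) v f
  rw [Subring.mem_center_iff.1 hf v, diff_mul, lmul_diff_of_mem_center hL hS hab hf, add_comm] at h1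
  exact (add_left_cancel h1).symm

end Differentials

/-! ### Abel's theorem over a commutative field with a derivation. -/

section Abel

variable {k : Type*} [Field k]

/-- A relation of the coefficients of a binary cubic form `C ∏ (αᵢ U + βᵢ V)` with its
discriminant. -/
theorem discriminant_eq {r₀ r₁ r₂ r₃ C : k} {α β : Fin 3 → k}
    (h3 : r₃ = C * (α 0 * α 1 * α 2))
    (h2 : r₂ = C * (α 0 * α 1 * β 2 + α 0 * β 1 * α 2 + β 0 * α 1 * α 2))
    (h1 : r₁ = C * (α 0 * β 1 * β 2 + β 0 * α 1 * β 2 + β 0 * β 1 * α 2))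
    (h0 : r₀ = C * (β 0 * β 1 * β 2)) :
    r₂ ^ 2 * r₁ ^ 2 - 4 * r₃ * r₁ ^ 3 - 4 * r₂ ^ 3 * r₀ - 27 * r₃ ^ 2 * r₀ ^ 2
        + 18 * r₃ * r₂ * r₁ * r₀
      = C ^ 4 * ((α 0 * β 1 - α 1 * β 0) * (α 0 * β 2 - α 2 * β 0)
        * (α 1 * β 2 - α 2 * β 1)) ^ 2 := by
  subst h3 h2 h1 h0
  ring

variable {M : Type*} [AddCommGroup M] [Module k M]

/-- The differential of a root of a binary cubic form `UV(a₃U + b₃V) - (a₄U + b₄V)(a₅U + b₅V)²`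
with constant `a₃, b₃, a₄, b₄`. -/
theorem root_differential (δ : k → M) (hadd : ∀ x y, δ (x + y) = δ x + δ y)
    (hmul : ∀ x y, δ (x * y) = x • δ y + y • δ x) {a₃ b₃ a₄ b₄ a₅ b₅ C α β α' β' α'' β'' : k}
    (ha₃ : δ a₃ = 0) (hb₃ : δ b₃ = 0) (ha₄ : δ a₄ = 0) (hb₄ : δ b₄ = 0)
    (h3 : a₄ * (a₅ * a₅) + C * (α * (α' * α'')) = 0)
    (h2 : b₄ * (a₅ * a₅) + (a₄ * (a₅ * b₅) + a₄ * (a₅ * b₅))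
      + C * (α * (α' * β'') + α * (β' * α'') + β * (α' * α'')) = a₃)
    (h1 : a₄ * (b₅ * b₅) + (b₄ * (a₅ * b₅) + b₄ * (a₅ * b₅))
      + C * (α * (β' * β'') + β * (α' * β'') + β * (β' * α'')) = b₃)
    (h0 : b₄ * (b₅ * b₅) + C * (β * (β' * β'')) = 0) :
    (2 * ((b₄ * α - a₄ * β) * (b₅ * α - a₅ * β))) • (α • δ b₅ - β • δ a₅)
      = (C * (α * β' - α' * β) * (α * β'' - α'' * β)) • (β • δ α - α • δ β) := by
  have hz : δ 0 = 0 := by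
    have := hadd 0 0
    rwa [add_zero, left_eq_add] at this
  have e3 := congrArg δ h3
  have e2 := congrArg δ h2
  have e1 := congrArg δ h1
  have e0 := congrArg δ h0
  simp only [hadd, hmul, hz, ha₃, hb₃, ha₄, hb₄, smul_zero, add_zero] at e3 e2 e1 e0
  -- The differentiated coefficients are evaluated at the root $(U,V)=(-\beta,\alpha)$ of $\alpha
  -- U+\beta V$. In the product rule only the derivative of the vanishing factor survives.
  linear_combination (norm := module) (-β ^ 3) • e3 + (β ^ 2 * α) • e2 - (β * α ^ 2) • e1 + (α ^ 3) • e0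

/-- The root of the cubic form satisfies the equation of the curve. -/
theorem root_equation {a₃ b₃ a₄ b₄ a₅ b₅ C α β α' β' α'' β'' : k}
    (h3 : a₄ * (a₅ * a₅) + C * (α * (α' * α'')) = 0)
    (h2 : b₄ * (a₅ * a₅) + (a₄ * (a₅ * b₅) + a₄ * (a₅ * b₅))
      + C * (α * (α' * β'') + α * (β' * α'') + β * (α' * α'')) = a₃)
    (h1 : a₄ * (b₅ * b₅) + (b₄ * (a₅ * b₅) + b₄ * (a₅ * b₅))
      + C * (α * (β' * β'') + β * (α' * β'') + β * (β' * α'')) = b₃)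
    (h0 : b₄ * (b₅ * b₅) + C * (β * (β' * β'')) = 0) :
    -(α * β * (b₃ * α - a₃ * β)) = (b₄ * α - a₄ * β) * (b₅ * α - a₅ * β) ^ 2 := by
  linear_combination β ^ 3 * h3 - β ^ 2 * α * h2 + β * α ^ 2 * h1 - α ^ 3 * h0

/-- The three points `1`, `2`, `(a, b)` are distinct, so `(a, b)` is not a root of
`UV(a₃U + b₃V)`. -/
theorem factor_ne_zero {a b a₃ b₃ α β : k} (ha : a ≠ 0) (hb : b ≠ 0) (hab : b₃ * a - a₃ * b ≠ 0)
    (hαβ : α ≠ 0 ∨ β ≠ 0) (h0 : α * β * (b₃ * α - a₃ * β) = 0) : b * α - a * β ≠ 0 := by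
  intro hz
  have hβ : β = b * α / a := by
    field_simp
    linear_combination -hz
  have hα : α ≠ 0 := by
    rintro rfl
    simp [hβ] at hαβ
  subst hβ
  have e : α * (b * α / a) * (b₃ * α - a₃ * (b * α / a))
      = α ^ 3 * b * (b₃ * a - a₃ * b) / a ^ 2 := by
    field_simp
  rw [e] at h0
  exact div_ne_zero (mul_ne_zero (mul_ne_zero (pow_ne_zero _ hα) hb) hab) (pow_ne_zero _ ha) h0

/-- Abel's theorem for the commutative field of central elements. -/
theorem exists_signs_sum_eq_zero (δ : k → M) (hadd : ∀ x y, δ (x + y) = δ x + δ y)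
    (hmul : ∀ x y, δ (x * y) = x • δ y + y • δ x) {D a₃ b₃ a₄ b₄ a₅ b₅ C : k} {α β w : Fin 3 → k}
    (ha₃ : δ a₃ = 0) (hb₃ : δ b₃ = 0) (ha₄ : δ a₄ = 0) (hb₄ : δ b₄ = 0) (hD : D ≠ 0)
    (h4a : a₄ ≠ 0) (h4b : b₄ ≠ 0) (h34 : b₃ * a₄ - a₃ * b₄ ≠ 0)
    (h5a : a₅ ≠ 0) (h5b : b₅ ≠ 0) (h35 : b₃ * a₅ - a₃ * b₅ ≠ 0)
    (hC : C ≠ 0) (h01 : α 0 * β 1 - α 1 * β 0 ≠ 0) (h02 : α 0 * β 2 - α 2 * β 0 ≠ 0)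
    (h12 : α 1 * β 2 - α 2 * β 1 ≠ 0)
    (h3 : a₄ * (a₅ * a₅) + C * (α 0 * α 1 * α 2) = 0)
    (h2 : b₄ * (a₅ * a₅) + (a₄ * (a₅ * b₅) + a₄ * (a₅ * b₅))
      + C * (α 0 * α 1 * β 2 + α 0 * β 1 * α 2 + β 0 * α 1 * α 2) = a₃)
    (h1 : a₄ * (b₅ * b₅) + (b₄ * (a₅ * b₅) + b₄ * (a₅ * b₅))
      + C * (α 0 * β 1 * β 2 + β 0 * α 1 * β 2 + β 0 * β 1 * α 2) = b₃)
    (h0 : b₄ * (b₅ * b₅) + C * (β 0 * β 1 * β 2) = 0)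
    (hw : ∀ i, w i ^ 2 = -(β i * D) * (α i * D) * (D * (α i * b₃ - β i * a₃))
      * (D * (α i * b₄ - β i * a₄))) :
    ∃ ε : Fin 3 → ℤˣ,
      ∑ i, (ε i : ℤ) • ((w i)⁻¹ * D) • (β i • δ (α i) - α i • δ (β i)) = 0 := by
  have root : ∀ i i' i'', (α 0 * α 1 * α 2 = α i * (α i' * α i'')) →
      (α 0 * α 1 * β 2 + α 0 * β 1 * α 2 + β 0 * α 1 * α 2
        = α i * (α i' * β i'') + α i * (β i' * α i'') + β i * (α i' * α i'')) →
      (α 0 * β 1 * β 2 + β 0 * α 1 * β 2 + β 0 * β 1 * α 2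
        = α i * (β i' * β i'') + β i * (α i' * β i'') + β i * (β i' * α i'')) →
      (β 0 * β 1 * β 2 = β i * (β i' * β i'')) → (α i ≠ 0 ∨ β i ≠ 0) →
      α i * β i' - α i' * β i ≠ 0 → α i * β i'' - α i'' * β i ≠ 0 →
      ∃ ε : ℤˣ, (ε : ℤ) • ((w i)⁻¹ * D) • (β i • δ (α i) - α i • δ (β i))
        = (2 / (D * C * (α i * β i' - α i' * β i) * (α i * β i'' - α i'' * β i)))
          • (α i • δ b₅ - β i • δ a₅) := by
    intro i i' i'' e3 e2 e1 e0 hne hn' hn''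
    rw [e3] at h3
    rw [e2] at h2
    rw [e1] at h1
    rw [e0] at h0
    have hd := root_differential δ hadd hmul ha₃ hb₃ ha₄ hb₄ h3 h2 h1 h0
    have hr := root_equation h3 h2 h1 h0
    -- Otherwise $(\alpha_i:\beta_i)$ would be the point $4$ or $5$, and by the root equation also
    -- one of $1,2,3$.
    have hm : (b₄ * α i - a₄ * β i) * (b₅ * α i - a₅ * β i) ≠ 0 := by
      have hz : (b₄ * α i - a₄ * β i) * (b₅ * α i - a₅ * β i) = 0 →
          α i * β i * (b₃ * α i - a₃ * β i) = 0 := by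
        intro hz
        linear_combination -hr - (b₅ * α i - a₅ * β i) * hz
      intro h0'
      exact mul_ne_zero (factor_ne_zero h4a h4b h34 hne (hz h0'))
        (factor_ne_zero h5a h5b h35 hne (hz h0')) h0'
    set m := (b₄ * α i - a₄ * β i) * (b₅ * α i - a₅ * β i) with hmdef
    -- Multiplying the root equation by $b_4\alpha_i-a_4\beta_i$ makes both sides squares, up to the
    -- factor $D^4$. The choice of square root is the sign $\epsilon_i$.
    have hwm : w i ^ 2 = (D ^ 2 * m) ^ 2 := by
      rw [hw i, hmdef]
      linear_combination D ^ 4 * (α i * b₄ - β i * a₄) * hr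
    have hX : ∀ s : k, s = D ^ 2 * m → (s⁻¹ * D) • (β i • δ (α i) - α i • δ (β i))
        = (2 / (D * C * (α i * β i' - α i' * β i) * (α i * β i'' - α i'' * β i)))
          • (α i • δ b₅ - β i • δ a₅) := by
      rintro s rfl
      have hc : C * (α i * β i' - α i' * β i) * (α i * β i'' - α i'' * β i) ≠ 0 :=
        mul_ne_zero (mul_ne_zero hC hn') hn''
      rw [← inv_smul_smul₀ hc (β i • δ (α i) - α i • δ (β i)), ← hd, smul_smul, smul_smul]
      congr 1
      field_simp
    rcases sq_eq_sq_iff_eq_or_eq_neg.1 hwm with hw' | hw'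
    · exact ⟨1, by simpa using hX _ hw'⟩
    · refine ⟨-1, ?_⟩
      rw [← hX (-w i) (by rw [hw', neg_neg]), inv_neg, neg_mul, neg_smul]
      simp
  obtain ⟨ε₀, hε₀⟩ := root 0 1 2 (by ring) (by ring) (by ring) (by ring) (by
    by_contra! hz
    simp [hz.1, hz.2] at h01) h01 h02
  obtain ⟨ε₁, hε₁⟩ := root 1 0 2 (by ring) (by ring) (by ring) (by ring) (by
    by_contra! hz
    simp [hz.1, hz.2] at h01) (by intro hz; exact h01 (by linear_combination -hz)) h12
  obtain ⟨ε₂, hε₂⟩ := root 2 0 1 (by ring) (by ring) (by ring) (by ring) (by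
    by_contra! hz
    simp [hz.1, hz.2] at h12) (by intro hz; exact h02 (by linear_combination -hz))
    (by intro hz; exact h12 (by linear_combination -hz))
  refine ⟨![ε₀, ε₁, ε₂], ?_⟩
  rw [Fin.sum_univ_three]
  simp only [Matrix.cons_val_zero, Matrix.cons_val_one, Matrix.cons_val]
  rw [hε₀, hε₁, hε₂]
  have n10 : α 1 * β 0 - α 0 * β 1 = -(α 0 * β 1 - α 1 * β 0) := by ring
  have n20 : α 2 * β 0 - α 0 * β 2 = -(α 0 * β 2 - α 2 * β 0) := by ring
  have n21 : α 2 * β 1 - α 1 * β 2 = -(α 1 * β 2 - α 2 * β 1) := by ring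
  rw [n10, n20, n21]
  -- Euler's identity for three roots. The hypothesis on $u$ is a $3\times3$ determinant with a
  -- repeated column, and it is applied to $u=\alpha$ and $u=\beta$.
  have key : ∀ p q r u₀ u₁ u₂ : k, p ≠ 0 → q ≠ 0 → r ≠ 0 → u₀ * r - u₁ * q + u₂ * p = 0 →
      2 / (D * C * p * q) * u₀ + 2 / (D * C * -p * r) * u₁ + 2 / (D * C * -q * -r) * u₂ = 0 := by
    intro p q r u₀ u₁ u₂ hp hq hr hu
    field_simp
    linear_combination 2 * hu
  have hα := key _ _ _ (α 0) (α 1) (α 2) h01 h02 h12 (by ring)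
  have hβ := key _ _ _ (β 0) (β 1) (β 2) h01 h02 h12 (by ring)
  linear_combination (norm := module) hα • δ b₅ - hβ • δ a₅

end Abel

/-! ### Central coordinates with respect to two points. -/

section CentralCoordinates

variable {L : Type v} [DivisionRing L] [Algebra ℂ L] {h : ℂ}

/-- The combination of two points with central coefficients. -/
def combPt (α β : Subring.center L) (p q : L × L) : L × L :=
  (α * p.1 + β * q.1, α * p.2 + β * q.2)

theorem ringBracket_combPt_right (α β : Subring.center L) (r p q : L × L) :
    ringBracket h r (combPt α β p q) = α * ringBracket h r p + β * ringBracket h r q := by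
  have hα := fun c => Subring.mem_center_iff.1 α.2 c
  have hβ := fun c => Subring.mem_center_iff.1 β.2 c
  simp only [ringBracket, combPt, mul_add, mul_sub, ← mul_assoc, hα, hβ, mul_smul_comm, smul_add]
  abel

theorem ringBracket_combPt_left (α β : Subring.center L) (r p q : L × L) :
    ringBracket h (combPt α β p q) r = α * ringBracket h p r + β * ringBracket h q r := by
  simp only [ringBracket, combPt, add_mul, mul_sub, mul_assoc, mul_smul_comm, smul_add]
  abel

variable {I : Type u} [LinearOrder I] {ψ : CoordField h I →ₐ[ℂ] L} {S : Set L}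

/-- The bracket of two coordinate points as an element of the center. -/
noncomputable def centralBracket (hL : subQAdjoin ψ Set.univ S = ⊤) (hS : S ⊆ Subring.center L)
    (i j : I) : Subring.center L :=
  ⟨ringBracket h (pt ψ i) (pt ψ j), ringBracket_pt_mem_center hL hS i j⟩

theorem centralBracket_ne_zero (hL : subQAdjoin ψ Set.univ S = ⊤) (hS : S ⊆ Subring.center L)
    {i j : I} (hij : i ≠ j) : centralBracket hL hS i j ≠ 0 :=
  fun h0 => ringBracket_pt_ne_zero ψ hij (congrArg Subtype.val h0)

/-- The Plücker-type identity divided by $(ab)$: $\alpha=-(bP)/(ab)$ and $\beta=(aP)/(ab)$. -/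
theorem exists_central_coordinates (hL : subQAdjoin ψ Set.univ S = ⊤)
    (hS : S ⊆ Subring.center L) {a b : I} (hab : a ≠ b) {P : L × L}
    (h1 : ringBracket h (pt ψ a) P ∈ Subring.center L)
    (h2 : ringBracket h (pt ψ b) P ∈ Subring.center L) :
    ∃ α β : Subring.center L, P = combPt α β (pt ψ a) (pt ψ b) ∧
      centralBracket hL hS a b * α = -⟨_, h2⟩ ∧ centralBracket hL hS a b * β = ⟨_, h1⟩ := by
  have hD := centralBracket_ne_zero hL hS hab
  have hD' : ringBracket h (pt ψ a) (pt ψ b) ≠ 0 := ringBracket_pt_ne_zero ψ hab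
  have hα : centralBracket hL hS a b * ((centralBracket hL hS a b)⁻¹ * -⟨_, h2⟩) = -⟨_, h2⟩ :=
    mul_inv_cancel_left₀ hD _
  have hβ : centralBracket hL hS a b * ((centralBracket hL hS a b)⁻¹ * ⟨_, h1⟩) = ⟨_, h1⟩ :=
    mul_inv_cancel_left₀ hD _
  refine ⟨_, _, ?_, hα, hβ⟩
  have hα' := congrArg Subtype.val hα
  have hβ' := congrArg Subtype.val hβ
  generalize (centralBracket hL hS a b)⁻¹ * -⟨_, h2⟩ = α at hα'
  generalize (centralBracket hL hS a b)⁻¹ * ⟨_, h1⟩ = β at hβ'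
  replace hα' : ringBracket h (pt ψ a) (pt ψ b) * α = -ringBracket h (pt ψ b) P := hα'
  replace hβ' : ringBracket h (pt ψ a) (pt ψ b) * β = ringBracket h (pt ψ a) P := hβ'
  have c1 := fun c => Subring.mem_center_iff.1 h1 c
  have c2 := fun c => Subring.mem_center_iff.1 h2 c
  refine Prod.ext (mul_left_cancel₀ hD' ?_) (mul_left_cancel₀ hD' ?_)
  · rw [← (pointRel_pt ψ a b).ringBracket_fst P, combPt, mul_add, ← mul_assoc, ← mul_assoc, hα',
      hβ', c1, c2, neg_mul]
    abel
  · rw [← (pointRel_pt ψ a b).ringBracket_snd P, combPt, mul_add, ← mul_assoc, ← mul_assoc, hα',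
      hβ', c1, c2, neg_mul]
    abel

theorem subset_subQAdjoin (ψ : CoordField h I →ₐ[ℂ] L) (J : Set I) (T : Set L) :
    (subQ ψ J : Set L) ⊆ subQAdjoin ψ J T :=
  fun _ hx => Subfield.subset_closure (Or.inl hx)

theorem pt_mem_subQAdjoin (ψ : CoordField h I →ₐ[ℂ] L) {J : Set I} (T : Set L) {i : I}
    (hi : i ∈ J) : (pt ψ i).1 ∈ subQAdjoin ψ J T ∧ (pt ψ i).2 ∈ subQAdjoin ψ J T :=
  ⟨subset_subQAdjoin ψ J T (Subfield.subset_closure (Or.inl (Or.inr ⟨i, hi, rfl⟩))),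
    subset_subQAdjoin ψ J T (Subfield.subset_closure (Or.inr ⟨i, hi, rfl⟩))⟩

theorem ringBracket_mem_subQAdjoin (ψ : CoordField h I →ₐ[ℂ] L) {J : Set I} {T : Set L}
    {p q : L × L} (hp : p.1 ∈ subQAdjoin ψ J T ∧ p.2 ∈ subQAdjoin ψ J T)
    (hq : q.1 ∈ subQAdjoin ψ J T ∧ q.2 ∈ subQAdjoin ψ J T) :
    ringBracket h p q ∈ subQAdjoin ψ J T := by
  have hh : algebraMap ℂ L h ∈ subQAdjoin ψ J T :=
    subset_subQAdjoin ψ J T (Subfield.subset_closure (Or.inl (Or.inl ⟨h, rfl⟩)))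
  rw [ringBracket, Algebra.smul_def]
  exact sub_mem (sub_mem (mul_mem hp.1 hq.2) (mul_mem hp.2 hq.1)) (mul_mem hh (mul_mem hp.2 hq.2))

/-- If the linear form `(oP)` with coefficients not involving `o` is central, then so are the
brackets of `P` with the points different from `o`. -/
theorem ringBracket_mem_center_of_form (hL : subQAdjoin ψ Set.univ S = ⊤)
    (hS : S ⊆ Subring.center L) {o a b : I} (hao : a ≠ o) (hbo : b ≠ o) (hab : a ≠ b) {T : Set L}
    (hT : IsCentralAlgebraic ψ {o}ᶜ T) {P : L × L}
    (hP : P.1 ∈ subQAdjoin ψ {o}ᶜ T ∧ P.2 ∈ subQAdjoin ψ {o}ᶜ T)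
    (hc : ringBracket h (pt ψ o) P ∈ Subring.center L) :
    ringBracket h (pt ψ a) P ∈ Subring.center L ∧ ringBracket h (pt ψ b) P ∈ Subring.center L := by
  obtain ⟨α, β, e, hα, hβ⟩ := exists_central_coordinates hL hS hab
    (ringBracket_pt_mem_center hL hS a o) (ringBracket_pt_mem_center hL hS b o)
  set D := centralBracket hL hS a b with hD
  have hD0 : (D : L) ≠ 0 := ringBracket_pt_ne_zero ψ hab
  have hα' : (D : L) * α = ringBracket h (pt ψ o) (pt ψ b) := by
    rw [(pointRel_pt ψ b o).ringBracket_swap]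
    exact congrArg Subtype.val hα
  have hβ' : (D : L) * β = -ringBracket h (pt ψ o) (pt ψ a) := by
    rw [← (pointRel_pt ψ o a).ringBracket_swap]
    exact congrArg Subtype.val hβ
  -- Expanding $p_o$ in $p_a,p_b$ exhibits $(oP)$ as a linear form in $U,V$ whose coefficients do
  -- not involve $o$.
  have hform : (D : L) * ringBracket h (pt ψ o) P
      = ringBracket h (pt ψ o) (pt ψ b) * ringBracket h (pt ψ a) P
        - ringBracket h (pt ψ o) (pt ψ a) * ringBracket h (pt ψ b) P := by
    rw [← hα', ← neg_eq_iff_eq_neg.2 hβ']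
    conv_lhs => rw [e, ringBracket_combPt_left]
    rw [mul_add, ← mul_assoc, ← mul_assoc, neg_mul, sub_neg_eq_add]
  have hUc := fun c => Subring.mem_center_iff.1 (ringBracket_pt_mem_center hL hS o a) c
  have hVc := fun c => Subring.mem_center_iff.1 (ringBracket_pt_mem_center hL hS o b) c
  have hPa := ringBracket_mem_subQAdjoin ψ (pt_mem_subQAdjoin ψ (J := {o}ᶜ) T hao) hP
  have hPb := ringBracket_mem_subQAdjoin ψ (pt_mem_subQAdjoin ψ (J := {o}ᶜ) T hbo) hP
  have hDform := fun c => Subring.mem_center_iff.1 (mul_mem D.2 hc) c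
  set U := ringBracket h (pt ψ o) (pt ψ a)
  set V := ringBracket h (pt ψ o) (pt ψ b)
  set A := ringBracket h (pt ψ a) P
  set B := ringBracket h (pt ψ b) P
  -- Since $D\,(oP)=VA-UB$ is central, $V[A,f]-U[B,f]=0$, and independence in degree one kills both
  -- commutators.
  have hcomm : ∀ f ∈ subQAdjoin ψ {o}ᶜ T, A * f = f * A ∧ B * f = f * B := by
    intro f hf
    have h0 : ∀ k ≤ 1, (if k = 0 then A * f - f * A else f * B - B * f) = 0 := by
      intro k hk
      refine eq_zero_of_sum_subQAdjoin hL hS hao hbo hab hT 1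
        (f := fun k => if k = 0 then A * f - f * A else f * B - B * f) ?_ ?_ hk
      · intro k _
        split_ifs
        · exact sub_mem (mul_mem hPa hf) (mul_mem hf hPa)
        · exact sub_mem (mul_mem hf hPb) (mul_mem hPb hf)
      · have := hDform f
        rw [hform] at this
        change ∑ k ∈ Finset.range 2, (if k = 0 then A * f - f * A else f * B - B * f)
          * (U ^ k * V ^ (1 - k)) = 0
        rw [Finset.sum_range_succ, Finset.sum_range_one]
        simp only [if_true, one_ne_zero, if_false, pow_zero, pow_one, one_mul, Nat.sub_zero,
          Nat.sub_self, mul_one]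
        rw [hUc, hVc, mul_sub, mul_sub, ← sub_eq_zero.2 this.symm]
        simp only [mul_sub, sub_mul, ← mul_assoc, hUc, hVc]
        abel
    have h1 := h0 0 zero_le_one
    have h2 := h0 1 le_rfl
    simp only [if_true, one_ne_zero, if_false] at h1 h2
    exact ⟨sub_eq_zero.1 h1, (sub_eq_zero.1 h2).symm⟩
  -- Commuting with the point $o$ is automatic, because $p_o$ is a central combination of $p_a$ and
  -- $p_b$.
  have hcenter : ∀ z : L, (∀ f ∈ subQAdjoin ψ {o}ᶜ T, z * f = f * z) → z ∈ Subring.center L := by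
    intro z hz
    have ho : ∀ v va vb : L, z * va = va * z → z * vb = vb * z → v = α * va + β * vb →
        z * v = v * z := by
      rintro v va vb h1 h2 rfl
      rw [mul_add, add_mul, ← mul_assoc, ← mul_assoc, Subring.mem_center_iff.1 α.2 z,
        Subring.mem_center_iff.1 β.2 z, mul_assoc, mul_assoc, h1, h2, mul_assoc, mul_assoc]
    have hpt : ∀ i, i ≠ o → z * (pt ψ i).1 = (pt ψ i).1 * z ∧ z * (pt ψ i).2 = (pt ψ i).2 * z :=
      fun i hi => ⟨hz _ (pt_mem_subQAdjoin ψ (J := {o}ᶜ) T hi).1,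
        hz _ (pt_mem_subQAdjoin ψ (J := {o}ᶜ) T hi).2⟩
    refine mem_center_of_commute hL hS (fun i => ?_) (fun i => ?_)
    · by_cases hi : i = o
      · rw [hi]
        exact ho _ _ _ (hpt a hao).1 (hpt b hbo).1 (congrArg Prod.fst e)
      · exact (hpt i hi).1
    · by_cases hi : i = o
      · rw [hi]
        exact ho _ _ _ (hpt a hao).2 (hpt b hbo).2 (congrArg Prod.snd e)
      · exact (hpt i hi).2
  exact ⟨hcenter A fun f hf => (hcomm f hf).1, hcenter B fun f hf => (hcomm f hf).2⟩

end CentralCoordinates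

/-! ### Nonvanishing of the discriminant. -/

section Discriminant

/-- The discriminant of the binary cubic form `UV(a₃U + b₃V)D² - (a₄U + b₄V)(a₅U + b₅V)²`. -/
def abelDiscriminant {A : Type*} [Ring A] (D a₃ b₃ a₄ b₄ a₅ b₅ : A) : A :=
  let r₃ := -(a₄ * a₅ ^ 2)
  let r₂ := D ^ 2 * a₃ - (b₄ * a₅ ^ 2 + 2 * a₄ * a₅ * b₅)
  let r₁ := D ^ 2 * b₃ - (a₄ * b₅ ^ 2 + 2 * b₄ * a₅ * b₅)
  let r₀ := -(b₄ * b₅ ^ 2)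
  r₂ ^ 2 * r₁ ^ 2 - 4 * r₃ * r₁ ^ 3 - 4 * r₂ ^ 3 * r₀ - 27 * r₃ ^ 2 * r₀ ^ 2
    + 18 * r₃ * r₂ * r₁ * r₀

/-- Noncommutative rings are allowed because the same expression is read in $H_I$, in an
endomorphism ring, in $L$ and in its centre. -/
theorem map_abelDiscriminant {A B : Type*} [Ring A] [Ring B] (f : A →+* B)
    (D a₃ b₃ a₄ b₄ a₅ b₅ : A) : f (abelDiscriminant D a₃ b₃ a₄ b₄ a₅ b₅)
      = abelDiscriminant (f D) (f a₃) (f b₃) (f a₄) (f b₄) (f a₅) (f b₅) := by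
  have h2 : f 2 = 2 := map_ofNat f 2
  have h4 : f 4 = 4 := map_ofNat f 4
  have h18 : f 18 = 18 := map_ofNat f 18
  have h27 : f 27 = 27 := map_ofNat f 27
  simp [abelDiscriminant, h2, h4, h18, h27]

variable {h : ℂ} {I : Type u} [LinearOrder I] {L : Type v} [DivisionRing L] [Algebra ℂ L]
  {ψ : CoordField h I →ₐ[ℂ] L} {S : Set L}

theorem abelDiscriminant_ne_zero (hL : subQAdjoin ψ Set.univ S = ⊤) (hS : S ⊆ Subring.center L)
    {e : Fin 6 → I} (he : Function.Injective e) :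
    abelDiscriminant (centralBracket hL hS (e 1) (e 2))
      (-centralBracket hL hS (e 2) (e 3)) (centralBracket hL hS (e 1) (e 3))
      (-centralBracket hL hS (e 2) (e 4)) (centralBracket hL hS (e 1) (e 4))
      (-centralBracket hL hS (e 2) (e 5)) (centralBracket hL hS (e 1) (e 5)) ≠ 0 := by
  let br : I → I → CoordAlg h I := fun i j => ringBracket h (coordPt h i) (coordPt h j)
  intro h0
  -- Points $1,4$ go to $(1,0)$, points $2,5$ to $(0,1)$ and point $3$ to $(1,2)$. The cubic becomes
  -- $UV(U+2V)-UV^2=UV(U+V)$, of discriminant $1$.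
  let d : I → ℂ := fun i => if i = e 1 then 1 else if i = e 4 then 1 else if i = e 3 then 1 else 0
  let c : I → ℂ := fun i => if i = e 2 then 1 else if i = e 5 then 1 else if i = e 3 then 2 else 0
  have hbr : ∀ i j, shiftRep h d c (br i j) = algebraMap ℂ _ (d i * c j - c i * d j) :=
    shiftRep_ringBracket h d c
  have hne := coordHom_ne_zero ψ (e := abelDiscriminant (br (e 1) (e 2)) (-br (e 2) (e 3))
    (br (e 1) (e 3)) (-br (e 2) (e 4)) (br (e 1) (e 4)) (-br (e 2) (e 5)) (br (e 1) (e 5)))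
    (d := d) (c := c) (s := 1) (by
      have := map_abelDiscriminant (shiftRep h d c : CoordAlg h I →+* Module.End ℂ (ℤ → ℂ))
        (br (e 1) (e 2)) (-br (e 2) (e 3))
        (br (e 1) (e 3)) (-br (e 2) (e 4)) (br (e 1) (e 4)) (-br (e 2) (e 5)) (br (e 1) (e 5))
      refine this.trans ?_
      simp only [RingHom.coe_coe, map_neg, hbr]
      rw [← map_neg, ← map_neg, ← map_neg, ← map_abelDiscriminant]
      congr 1
      simp [d, c, abelDiscriminant, he.eq_iff]
      try norm_num) one_ne_zero
  refine hne ?_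
  have h1 := map_abelDiscriminant (coordHom ψ : CoordAlg h I →+* L)
        (br (e 1) (e 2)) (-br (e 2) (e 3))
        (br (e 1) (e 3)) (-br (e 2) (e 4)) (br (e 1) (e 4)) (-br (e 2) (e 5)) (br (e 1) (e 5))
  have h2 := (map_abelDiscriminant (Subring.center L).subtype _ _ _ _ _ _ _).symm.trans
    (congrArg Subtype.val h0)
  refine h1.trans (Eq.trans ?_ h2)
  simp only [RingHom.coe_coe, map_neg, br, coordHom_ringBracket]
  rfl

end Discriminant

/-! ### The elliptic differential in central coordinates. -/

section EllipticDifferential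

variable {h : ℂ} {I : Type u} [LinearOrder I] {L : Type v} [DivisionRing L] [Algebra ℂ L]
  {ψ : CoordField h I →ₐ[ℂ] L} {K : Set I} {S : Set L}

theorem diff_ringBracket_eq_zero {i j : I} (hi : i ∉ K) (hj : j ∉ K) :
    diff ψ K S (ringBracket h (pt ψ i) (pt ψ j)) = 0 := by
  rw [(pointRel_pt ψ i j).ringBracket_eq, sub_eq_add_neg, diff_add, diff_neg, diff_mul, diff_mul,
    diff_fst_eq_zero hi, diff_fst_eq_zero hj, diff_snd_eq_zero hi, diff_snd_eq_zero hj]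
  simp

theorem diff_eq_zero_of_mul {D z u : L} (hD : D ≠ 0) (hdD : diff ψ K S D = 0)
    (hdu : diff ψ K S u = 0) (e : D * z = u) : diff ψ K S z = 0 := by
  have := diff_mul (ψ := ψ) (K := K) (S := S) D z
  rw [e, hdu, hdD, zero_rmul, zero_add] at this
  rw [← lmul_inv_cancel hD (diff ψ K S z), ← this, lmul_zero]

/-- The elliptic differential in terms of central homogeneous coordinates with respect to two
constant points. -/
theorem ellipticDiff_combPt (hL : subQAdjoin ψ Set.univ S = ⊤)
    (hS : S ⊆ Subring.center L) {a b : I} (hab : a ≠ b) (ha : a ∉ K) (hb : b ∉ K)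
    (α β : Subring.center L) (w : L) :
    ellipticDiff ψ K S w (combPt α β (pt ψ a) (pt ψ b))
      = lmul (w⁻¹ * ringBracket h (pt ψ a) (pt ψ b))
        (lmul (β : L) (diff ψ K S α) - lmul (α : L) (diff ψ K S β)) := by
  have hd : ∀ u v : L, diff ψ K S u = 0 → diff ψ K S v = 0 →
      diff ψ K S (α * u + β * v) = lmul u (diff ψ K S α) + lmul v (diff ψ K S β) := by
    intro u v hu hv
    rw [diff_add, diff_mul, diff_mul, hu, hv, lmul_zero, lmul_zero, add_zero, add_zero,
      lmul_diff_center hL hS hab α.2, lmul_diff_center hL hS hab β.2]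
  have hα := fun c => Subring.mem_center_iff.1 α.2 c
  have hβ := fun c => Subring.mem_center_iff.1 β.2 c
  have e1 : ringBracket h (combPt α β (pt ψ a) (pt ψ b)) (pt ψ a)
      = -(ringBracket h (pt ψ a) (pt ψ b) * β) := by
    rw [ringBracket_combPt_left, (pointRel_pt ψ a a).ringBracket_self,
      (pointRel_pt ψ a b).ringBracket_swap, hβ, mul_zero, zero_add, mul_neg]
  have e2 : ringBracket h (combPt α β (pt ψ a) (pt ψ b)) (pt ψ b)
      = ringBracket h (pt ψ a) (pt ψ b) * α := by
    rw [ringBracket_combPt_left, (pointRel_pt ψ b b).ringBracket_self, hα, mul_zero, add_zero]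
  rw [ellipticDiff, lmul_mul]
  congr 1
  have hX : diff ψ K S (combPt α β (pt ψ a) (pt ψ b)).1
      = lmul (pt ψ a).1 (diff ψ K S α) + lmul (pt ψ b).1 (diff ψ K S β) :=
    hd _ _ (diff_fst_eq_zero ha) (diff_fst_eq_zero hb)
  have hY : diff ψ K S (combPt α β (pt ψ a) (pt ψ b)).2
      = lmul (pt ψ a).2 (diff ψ K S α) + lmul (pt ψ b).2 (diff ψ K S β) :=
    hd _ _ (diff_snd_eq_zero ha) (diff_snd_eq_zero hb)
  -- The coefficient of $d\alpha$ is $-(Pa)=(ab)\beta$ and that of $d\beta$ is $-(Pb)=-(ab)\alpha$.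
  rw [hX, hY, lmul_sub, ← lmul_mul, ← lmul_mul, ← e2, ← neg_eq_iff_eq_neg.2 e1]
  simp only [ringBracket, lmul_add, ← lmul_mul, neg_lmul, sub_lmul, smul_mul_assoc]
  abel

end EllipticDifferential

/-! ### Comparison of coefficients of cubic forms. -/

section Roots

theorem mem_of_mul_mem {L : Type*} [DivisionRing L] {F : Subfield L} {D z : L} (hD : D ≠ 0) (hDF : D ∈ F) (hz : D * z ∈ F) :
    z ∈ F := by
  rw [← inv_mul_cancel_left₀ hD z]
  exact mul_mem (inv_mem hDF) hz

variable {h : ℂ} {I : Type u} [LinearOrder I] {L : Type v} [DivisionRing L] [Algebra ℂ L]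
  {ψ : CoordField h I →ₐ[ℂ] L} {S : Set L}

/-- Comparison of the coefficients of a binary cubic form with central coefficients with those of
a multiple of a product of central linear forms. -/
theorem compare_coefficients (hL : subQAdjoin ψ Set.univ S = ⊤) (hS : S ⊆ Subring.center L)
    {o a b : I} (hao : a ≠ o) (hbo : b ≠ o) (hab : a ≠ b) {T : Set L}
    (hT : IsCentralAlgebraic ψ {o}ᶜ T) {C : L} (hC : C ∈ subQAdjoin ψ {o}ᶜ T)
    {r s : Fin 4 → Subring.center L} (hrF : ∀ k, (r k : L) ∈ subQAdjoin ψ {o}ᶜ T)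
    (hsF : ∀ k, (s k : L) ∈ subQAdjoin ψ {o}ᶜ T)
    (e : ((∑ k : Fin 4, r k * (centralBracket hL hS o a ^ (k : ℕ)
        * centralBracket hL hS o b ^ (3 - (k : ℕ))) : Subring.center L) : L)
      = C * (∑ k : Fin 4, s k * (centralBracket hL hS o a ^ (k : ℕ)
        * centralBracket hL hS o b ^ (3 - (k : ℕ))) : Subring.center L)) (k : Fin 4) :
    (r k : L) = C * s k := by
  have key := eq_zero_of_sum_subQAdjoin hL hS hao hbo hab hT 3
    (f := fun k => if hk : k < 4 then (r ⟨k, hk⟩ : L) - C * s ⟨k, hk⟩ else 0) ?_ ?_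
    (Nat.le_of_lt_succ k.2)
  · simpa [sub_eq_zero] using key
  · intro k hk
    rw [dif_pos (Nat.lt_succ_of_le hk)]
    exact sub_mem (hrF _) (mul_mem hC (hsF _))
  · rw [← sub_eq_zero.2 e, Finset.sum_range]
    simp only [Fin.is_lt, dite_true, AddSubmonoidClass.coe_finsetSum, Finset.mul_sum,
      ← Finset.sum_sub_distrib, Subring.coe_mul, Subring.coe_pow, sub_mul, mul_assoc]
    rfl

end Roots

end HDeformed

/-! ### Abel's theorem for elliptic differentials. -/

open HDeformed in
theorem theorem22 (h : ℂ) {I : Type*} [LinearOrder I]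
    -- the six distinct indices `0, ..., 5`, and the set `K` of indices of variable points
    (e : Fin 6 → I) (he : Function.Injective e)
    (K : Set I) (h0K : e 0 ∈ K) (h5K : e 5 ∈ K)
    (h1K : e 1 ∉ K) (h2K : e 2 ∉ K) (h3K : e 3 ∉ K) (h4K : e 4 ∉ K)
    -- the skew field extension `L` of `Q_I`
    {L : Type*} [DivisionRing L] [Algebra ℂ L] (ψ : HDeformed.CoordField h I →ₐ[ℂ] L)
    -- `T` generates the splitting field `Q_{I \ {0}}^T`
    (T : Set L) (hT : HDeformed.IsCentralAlgebraic ψ {e 0}ᶜ T)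
    -- the decomposition of `r` into linear factors with coordinates `P i = (X_i, Y_i)`
    (C : L) (hC : C ∈ HDeformed.subQAdjoin ψ {e 0}ᶜ T)
    (P : Fin 3 → L × L)
    (hP : ∀ i, (P i).1 ∈ HDeformed.subQAdjoin ψ {e 0}ᶜ T ∧
      (P i).2 ∈ HDeformed.subQAdjoin ψ {e 0}ᶜ T)
    (hP_central : ∀ i, HDeformed.bracket h (HDeformed.pt ψ (e 0)) (P i) ∈ Subring.center L)
    (hr : HDeformed.bracket h (HDeformed.pt ψ (e 0)) (HDeformed.pt ψ (e 1))
          * HDeformed.bracket h (HDeformed.pt ψ (e 0)) (HDeformed.pt ψ (e 2))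
          * HDeformed.bracket h (HDeformed.pt ψ (e 0)) (HDeformed.pt ψ (e 3))
        - HDeformed.bracket h (HDeformed.pt ψ (e 0)) (HDeformed.pt ψ (e 4))
          * HDeformed.bracket h (HDeformed.pt ψ (e 0)) (HDeformed.pt ψ (e 5)) ^ 2
      = C * (HDeformed.bracket h (HDeformed.pt ψ (e 0)) (P 0)
          * HDeformed.bracket h (HDeformed.pt ψ (e 0)) (P 1)
          * HDeformed.bracket h (HDeformed.pt ψ (e 0)) (P 2)))
    -- the central square roots `w i` of `(X_i 1)(X_i 2)(X_i 3)(X_i 4)`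
    (w : Fin 3 → L) (hw_central : ∀ i, w i ∈ Subring.center L)
    (hw : ∀ i, w i ^ 2 =
      HDeformed.bracket h (P i) (HDeformed.pt ψ (e 1))
        * HDeformed.bracket h (P i) (HDeformed.pt ψ (e 2))
        * HDeformed.bracket h (P i) (HDeformed.pt ψ (e 3))
        * HDeformed.bracket h (P i) (HDeformed.pt ψ (e 4)))
    -- `L` is generated by `Q_I`, `T` and the `w i`
    (hL : HDeformed.subQAdjoin ψ Set.univ (T ∪ Set.range w) = ⊤) :
    ∃ ε : Fin 3 → ℤˣ,
      ∑ i, (ε i : ℤ) • HDeformed.ellipticDiff ψ K (T ∪ Set.range w) (w i) (P i) = 0 := by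
  have hS : T ∪ Set.range w ⊆ Subring.center L := by
    rintro s (hs | ⟨i, rfl⟩)
    · exact (hT s hs).1
    · exact hw_central i
  have hne : ∀ i j : Fin 6, i ≠ j → e i ≠ e j := fun i j hij => he.ne hij
  have h12 : e 1 ≠ e 2 := hne _ _ (by decide)
  have h10 : e 1 ≠ e 0 := hne _ _ (by decide)
  have h20 : e 2 ≠ e 0 := hne _ _ (by decide)
  have cen : ∀ i j, ringBracket h (pt ψ (e i)) (pt ψ (e j)) ∈ Subring.center L :=
    fun i j => ringBracket_pt_mem_center hL hS (e i) (e j)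
  have hcoord := fun j => exists_central_coordinates hL hS h12 (cen 1 j) (cen 2 j)
  choose a b hab ha hb using hcoord
  have hPcen := fun i => ringBracket_mem_center_of_form hL hS h10 h20 h12 hT (hP i) (hP_central i)
  have hPcoord := fun i => exists_central_coordinates hL hS h12 (hPcen i).1 (hPcen i).2
  choose α β hαβ hα hβ using hPcoord
  have hnz : ∀ i j : Fin 6, i ≠ j → centralBracket hL hS (e i) (e j) ≠ 0 :=
    fun i j hij => centralBracket_ne_zero hL hS (hne i j hij)
  have hDF : (centralBracket hL hS (e 1) (e 2) : L) ∈ subQAdjoin ψ {e 0}ᶜ T :=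
    ringBracket_mem_subQAdjoin ψ (pt_mem_subQAdjoin ψ T h10) (pt_mem_subQAdjoin ψ T h20)
  have hD0 : (centralBracket hL hS (e 1) (e 2) : L) ≠ 0 := ringBracket_pt_ne_zero ψ h12
  set D := centralBracket hL hS (e 1) (e 2) with hDdef
  set U := centralBracket hL hS (e 0) (e 1) with hUdef
  set V := centralBracket hL hS (e 0) (e 2) with hVdef
  replace ha : ∀ j, D * a j = -centralBracket hL hS (e 2) (e j) := ha
  replace hb : ∀ j, D * b j = centralBracket hL hS (e 1) (e j) := hb
  have hjF : ∀ j : Fin 6, j ≠ 0 → (a j : L) ∈ subQAdjoin ψ {e 0}ᶜ T ∧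
      (b j : L) ∈ subQAdjoin ψ {e 0}ᶜ T := by
    intro j hj
    have hj' := pt_mem_subQAdjoin ψ (J := {e 0}ᶜ) T (hne j 0 hj)
    constructor
    · refine mem_of_mul_mem hD0 hDF ?_
      rw [← Subring.coe_mul, ha]
      exact neg_mem (ringBracket_mem_subQAdjoin ψ (pt_mem_subQAdjoin ψ T h20) hj')
    · refine mem_of_mul_mem hD0 hDF ?_
      rw [← Subring.coe_mul, hb]
      exact ringBracket_mem_subQAdjoin ψ (pt_mem_subQAdjoin ψ T h10) hj'
  have hPF : ∀ i, (α i : L) ∈ subQAdjoin ψ {e 0}ᶜ T ∧ (β i : L) ∈ subQAdjoin ψ {e 0}ᶜ T := by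
    intro i
    constructor
    · refine mem_of_mul_mem hD0 hDF ?_
      rw [← Subring.coe_mul, hα]
      exact neg_mem (ringBracket_mem_subQAdjoin ψ (pt_mem_subQAdjoin ψ T h20) (hP i))
    · refine mem_of_mul_mem hD0 hDF ?_
      rw [← Subring.coe_mul, hβ]
      exact ringBracket_mem_subQAdjoin ψ (pt_mem_subQAdjoin ψ T h10) (hP i)
  have hform : ∀ (x y : Subring.center L), bracket h (pt ψ (e 0))
      (combPt x y (pt ψ (e 1)) (pt ψ (e 2))) = ((x * U + y * V : Subring.center L) : L) :=
    fun x y => ringBracket_combPt_right x y _ _ _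
  have hU : bracket h (pt ψ (e 0)) (pt ψ (e 1)) = (U : L) := rfl
  have hV : bracket h (pt ψ (e 0)) (pt ψ (e 2)) = (V : L) := rfl
  rw [hU, hV, hab 3, hab 4, hab 5, hαβ 0, hαβ 1, hαβ 2, hform, hform, hform, hform, hform,
    hform] at hr
  -- comparison of coefficients
  have hcoef := compare_coefficients hL hS h10 h20 h12 hT hC
    (r := ![-(b 4 * (b 5 * b 5)),
      b 3 - (a 4 * (b 5 * b 5) + (b 4 * (a 5 * b 5) + b 4 * (a 5 * b 5))),
      a 3 - (b 4 * (a 5 * a 5) + (a 4 * (a 5 * b 5) + a 4 * (a 5 * b 5))),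
      -(a 4 * (a 5 * a 5))])
    (s := ![β 0 * β 1 * β 2, α 0 * β 1 * β 2 + β 0 * α 1 * β 2 + β 0 * β 1 * α 2,
      α 0 * α 1 * β 2 + α 0 * β 1 * α 2 + β 0 * α 1 * α 2, α 0 * α 1 * α 2])
    (by
      have h3 := hjF 3 (by decide)
      have h4 := hjF 4 (by decide)
      have h5 := hjF 5 (by decide)
      intro k
      fin_cases k
      · exact neg_mem (mul_mem h4.2 (mul_mem h5.2 h5.2))
      · exact sub_mem h3.2 (add_mem (mul_mem h4.1 (mul_mem h5.2 h5.2))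
          (add_mem (mul_mem h4.2 (mul_mem h5.1 h5.2)) (mul_mem h4.2 (mul_mem h5.1 h5.2))))
      · exact sub_mem h3.1 (add_mem (mul_mem h4.2 (mul_mem h5.1 h5.1))
          (add_mem (mul_mem h4.1 (mul_mem h5.1 h5.2)) (mul_mem h4.1 (mul_mem h5.1 h5.2))))
      · exact neg_mem (mul_mem h4.1 (mul_mem h5.1 h5.1)))
    (by
      have hm : ∀ x y z : Subring.center L, (x : L) ∈ subQAdjoin ψ {e 0}ᶜ T →
          (y : L) ∈ subQAdjoin ψ {e 0}ᶜ T → (z : L) ∈ subQAdjoin ψ {e 0}ᶜ T →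
          ((x * y * z : Subring.center L) : L) ∈ subQAdjoin ψ {e 0}ᶜ T :=
        fun x y z hx hy hz => mul_mem (mul_mem hx hy) hz
      intro k
      fin_cases k
      · exact hm _ _ _ (hPF 0).2 (hPF 1).2 (hPF 2).2
      · exact add_mem (add_mem (hm _ _ _ (hPF 0).1 (hPF 1).2 (hPF 2).2)
          (hm _ _ _ (hPF 0).2 (hPF 1).1 (hPF 2).2)) (hm _ _ _ (hPF 0).2 (hPF 1).2 (hPF 2).1)
      · exact add_mem (add_mem (hm _ _ _ (hPF 0).1 (hPF 1).1 (hPF 2).2)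
          (hm _ _ _ (hPF 0).1 (hPF 1).2 (hPF 2).1)) (hm _ _ _ (hPF 0).2 (hPF 1).1 (hPF 2).1)
      · exact hm _ _ _ (hPF 0).1 (hPF 1).1 (hPF 2).1)
    (by
      refine Eq.trans (Eq.trans ?_ hr) ?_
      · norm_cast
        simp only [Fin.sum_univ_four, Matrix.cons_val, ← hUdef, ← hVdef, Fin.coe_ofNat_eq_mod]
        ring
      · norm_cast
        congr 2
        simp only [Fin.sum_univ_four, Matrix.cons_val, ← hUdef, ← hVdef, Fin.coe_ofNat_eq_mod]
        ring)
  have ha4 : a 4 ≠ 0 := by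
    intro h0
    have := ha 4
    rw [h0, mul_zero, eq_comm, neg_eq_zero] at this
    exact hnz 2 4 (by decide) this
  have ha5 : a 5 ≠ 0 := by
    intro h0
    have := ha 5
    rw [h0, mul_zero, eq_comm, neg_eq_zero] at this
    exact hnz 2 5 (by decide) this
  have hb4 : b 4 ≠ 0 := by
    intro h0
    have := hb 4
    rw [h0, mul_zero] at this
    exact hnz 1 4 (by decide) this.symm
  have hb5 : b 5 ≠ 0 := by
    intro h0
    have := hb 5
    rw [h0, mul_zero] at this
    exact hnz 1 5 (by decide) this.symm
  have k3 := hcoef 3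
  have k2 := hcoef 2
  have k1 := hcoef 1
  have k0 := hcoef 0
  simp only [Matrix.cons_val] at k3 k2 k1 k0
  have hπ : α 0 * α 1 * α 2 ≠ 0 := by
    intro h0
    rw [h0, Subring.coe_zero, mul_zero] at k3
    have : -(a 4 * (a 5 * a 5)) = 0 := Subtype.ext k3
    exact neg_ne_zero.2 (mul_ne_zero ha4 (mul_ne_zero ha5 ha5)) this
  -- The $U^3$ coefficient $-a_4a_5^2=C\,\alpha_0\alpha_1\alpha_2$ is nonzero, which forces $C$ to
  -- be central. From here on everything takes place in a commutative field.
  obtain ⟨C', rfl⟩ : ∃ C' : Subring.center L, (C' : L) = C := by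
    refine ⟨-(a 4 * (a 5 * a 5)) * (α 0 * α 1 * α 2)⁻¹, ?_⟩
    rw [Subring.coe_mul, k3, mul_assoc, ← Subring.coe_mul, mul_inv_cancel₀ hπ, Subring.coe_one,
      mul_one]
  replace k3 : -(a 4 * (a 5 * a 5)) = C' * _ := Subtype.ext k3
  replace k2 : a 3 - _ = C' * _ := Subtype.ext k2
  replace k1 : b 3 - _ = C' * _ := Subtype.ext k1
  replace k0 : -(b 4 * (b 5 * b 5)) = C' * _ := Subtype.ext k0
  have hD : D ≠ 0 := hnz 1 2 (by decide)
  have hC' : C' ≠ 0 := by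
    rintro rfl
    rw [zero_mul] at k3
    exact neg_ne_zero.2 (mul_ne_zero ha4 (mul_ne_zero ha5 ha5)) k3
  -- the roots are distinct
  have hdisc : abelDiscriminant D (D * a 3) (D * b 3) (D * a 4) (D * b 4) (D * a 5) (D * b 5)
      ≠ 0 := by
    rw [ha 3, ha 4, ha 5, hb 3, hb 4, hb 5]
    exact abelDiscriminant_ne_zero hL hS he
  -- The brackets themselves are the coordinates scaled by $D$, so the cubic is scaled by $D^3$ and
  -- its discriminant, of degree four in the coefficients, by $D^{12}$.
  have hdisc' : abelDiscriminant D (D * a 3) (D * b 3) (D * a 4) (D * b 4) (D * a 5) (D * b 5)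
      = D ^ 12 * (C' ^ 4 * ((α 0 * β 1 - α 1 * β 0) * (α 0 * β 2 - α 2 * β 0)
        * (α 1 * β 2 - α 2 * β 1)) ^ 2) := by
    rw [← discriminant_eq k3 k2 k1 k0, abelDiscriminant]
    ring
  rw [hdisc'] at hdisc
  have hroots := (pow_ne_zero_iff two_ne_zero).1
    (right_ne_zero_of_mul (right_ne_zero_of_mul hdisc))
  have h3j : ∀ j : Fin 6, j ≠ 3 → b 3 * a j - a 3 * b j ≠ 0 := by
    intro j hj h0
    refine hnz 3 j hj.symm (Subtype.ext ?_)
    have : ringBracket h (pt ψ (e 3)) (pt ψ (e j)) = (((a 3 * b j - b 3 * a j) * D :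
        Subring.center L) : L) := by
      rw [hab 3, hab j, ringBracket_combPt_left, ringBracket_combPt_right,
        ringBracket_combPt_right, (pointRel_pt ψ _ _).ringBracket_self,
        (pointRel_pt ψ _ _).ringBracket_self, (pointRel_pt ψ (e 1) (e 2)).ringBracket_swap]
      change (a 3 : L) * (a j * 0 + b j * D) + b 3 * (a j * -D + b j * 0)
        = (a 3 * b j - b 3 * a j) * D
      noncomm_ring
    refine this.trans ?_
    rw [show a 3 * b j - b 3 * a j = 0 by linear_combination -h0, zero_mul]
  have hPbr : ∀ i (x y : Subring.center L), bracket h (P i)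
      (combPt x y (pt ψ (e 1)) (pt ψ (e 2)))
        = ((x * -(β i * D) + y * (α i * D) : Subring.center L) : L) := by
    intro i x y
    rw [hαβ i, bracket_eq_ringBracket, ringBracket_combPt_right, ringBracket_combPt_left,
      ringBracket_combPt_left, (pointRel_pt ψ _ _).ringBracket_self,
      (pointRel_pt ψ _ _).ringBracket_self, (pointRel_pt ψ (e 1) (e 2)).ringBracket_swap]
    change (x : L) * (α i * 0 + β i * -D) + y * (α i * D + β i * 0)
      = x * -(β i * D) + y * (α i * D)
    noncomm_ring
  have hw' : ∀ i, (⟨w i, hw_central i⟩ : Subring.center L) ^ 2 = -(β i * D) * (α i * D)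
      * (D * (α i * b 3 - β i * a 3)) * (D * (α i * b 4 - β i * a 4)) := by
    intro i
    have e1 := hPbr i 1 0
    have e2 := hPbr i 0 1
    simp only [combPt, Subring.coe_one, Subring.coe_zero, one_mul, zero_mul, add_zero, zero_add,
      Prod.mk.eta] at e1 e2
    refine Subtype.ext ((hw i).trans ?_)
    rw [e1, e2, hab 3, hab 4, hPbr, hPbr]
    norm_cast
    ring
  -- the module of central differentials
  let _ : Module (Subring.center L) (DiffModule ψ K (T ∪ Set.range w)) :=
    Module.compHom _ ((lmulHom L).comp (Subring.center L).subtype)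
  let δ : Subring.center L → DiffModule ψ K (T ∪ Set.range w) :=
    fun z => diff ψ K (T ∪ Set.range w) (z : L)
  have hadd : ∀ x y, δ (x + y) = δ x + δ y := fun x y => diff_add _ _
  have hmul : ∀ x y, δ (x * y) = x • δ y + y • δ x := by
    intro x y
    refine (diff_mul (x : L) (y : L)).trans ?_
    rw [← lmul_diff_center hL hS h12 x.2, add_comm]
    rfl
  have hconst : ∀ j : Fin 6, e j ∉ K → δ (a j) = 0 ∧ δ (b j) = 0 := by
    intro j hj
    constructor
    · refine diff_eq_zero_of_mul hD0 (diff_ringBracket_eq_zero h1K h2K) ?_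
        (congrArg Subtype.val (ha j))
      rw [Subring.coe_neg, diff_neg]
      exact neg_eq_zero.2 (diff_ringBracket_eq_zero h2K hj)
    · exact diff_eq_zero_of_mul hD0 (diff_ringBracket_eq_zero h1K h2K)
        (diff_ringBracket_eq_zero h1K hj) (congrArg Subtype.val (hb j))
  obtain ⟨ε, hε⟩ := exists_signs_sum_eq_zero δ hadd hmul (hconst 3 h3K).1 (hconst 3 h3K).2
    (hconst 4 h4K).1 (hconst 4 h4K).2 hD ha4 hb4 (h3j 4 (by decide)) ha5 hb5 (h3j 5 (by decide))
    hC' (left_ne_zero_of_mul (left_ne_zero_of_mul hroots))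
    (right_ne_zero_of_mul (left_ne_zero_of_mul hroots)) (right_ne_zero_of_mul hroots)
    (by linear_combination -k3) (by linear_combination -k2) (by linear_combination -k1)
    (by linear_combination -k0) hw'
  refine ⟨ε, Eq.trans (Finset.sum_congr rfl fun i _ => ?_) hε⟩
  rw [hαβ i, ellipticDiff_combPt hL hS h12 h1K h2K]
  rfl
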